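/- Let $M$ be a finite von Neumann algebra, let $N \subseteq Z(M)$ be a von Neumann subalgebra of its center, let $E : M \to N$ be a normal, faithful, tracial conditional expectation, and let $\mathcal{U}$ be a character on $N$ (a nonzero multiplicative linear functional $N \to \mathbb{C}$) that is countably incomplete, i.e. there is a decreasing sequence of projections $p_n \in N$ with $p_n \searrow 0$ and $\mathcal{U}(p_n) = 1$ for all $n$. Let $$M^{/E,\mathcal{U}} = M / I_{E,\mathcal{U}}, \qquad I_{E,\mathcal{U}} = \{x \in M : \mathcal{U}(E(x^*x)) = 0\},$$ be the ultrafiber, equipped with the quotient of the operator norm and the trace $\tau_{E,\mathcal{U}}(x + I_{E,\mathcal{U}}) = \mathcal{U}(E(x))$. Then $M^{/E,\mathcal{U}}$ is countably saturated, that is, $\aleph_1$-saturated, in the following sense. Formulas in the language of tracial von Neumann algebras are built from the basic formulas $\operatorname{Re} \operatorname{tr}(p)$ and $\operatorname{Im} \operatorname{tr}(p)$, where $p$ is a non-commutative $*$-polynomial in finitely many variables, by applying continuous connectives $f : \mathbb{R}^k \to \mathbb{R}$ and quantifiers $\sup_y$ and $\inf_y$; they are interpreted in a tracial algebra by reading $\operatorname{tr}$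 as its trace and letting the quantifiers range over its closed operator-norm unit ball. Write $(M^{/E,\mathcal{U}})_1$ for the closed unit ball of $M^{/E,\mathcal{U}}$. Then for every countable set $A \subseteq (M^{/E,\mathcal{U}})_1$, every $n \in \mathbb{N}$, and every (not necessarily countable) collection $\Gamma$ of formulas with free variables in $\{x_1,\dots,x_n\} \cup \{y_a\}_{a \in A}$: if for every finite $\Gamma_0 \subseteq \Gamma$ and every $\epsilon > 0$ there are $x_1,\dots,x_n \in (M^{/E,\mathcal{U}})_1$ with $|\varphi^{M^{/E,\mathcal{U}}}(x_1,\dots,x_n,\{a\}_{a \in A})| < \epsilon$ for all $\varphi \in \Gamma_0$, then there are $x_1,\dots,x_n \in (M^{/E,\mathcal{U}})_1$ with $\varphi^{M^{/E,\mathcal{U}}}(x_1,\dots,x_n,\{a\}_{a \in A}) = 0$ for all $\varphi \in \Gamma$. -/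

import Mathlib

open scoped ComplexOrder Cardinal

noncomputable section

universe u

namespace TracialModelTheory

/-! ## Formulas in the language of tracial von Neumann algebras -/

/-- Non-commutative (unital, complex) `*`-polynomials in the variables `V`: the free algebra on the
letters `x = Sum.inl x` and `x^* = Sum.inr x`. -/
abbrev StarPoly (V : Type u) : Type u := FreeAlgebra ℂ (V ⊕ V)

/-- `Formula α k` is the type of formulas whose free variables lie in `α ⊔ {z_0, …, z_{k-1}}`; the
`k` extra variables are those waiting to be bound by a quantifier, and a quantifier binds the last
of them (the convention of `FirstOrder.Language.BoundedFormula`). -/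
inductive Formula (α : Type u) : ℕ → Type u
  /-- the basic formula `Re tr(p)` -/
  | reTr {k : ℕ} (p : StarPoly (α ⊕ Fin k)) : Formula α k
  /-- the basic formula `Im tr(p)` -/
  | imTr {k : ℕ} (p : StarPoly (α ⊕ Fin k)) : Formula α k
  /-- the formula `f(φ_1, …, φ_m)` for a continuous connective `f : ℝ^m → ℝ` -/
  | conn {k m : ℕ} (f : C(Fin m → ℝ, ℝ)) (φ : Fin m → Formula α k) : Formula α k
  /-- the formula `sup_y φ` -/
  | sup {k : ℕ} (φ : Formula α (k + 1)) : Formula α k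
  /-- the formula `inf_y φ` -/
  | inf {k : ℕ} (φ : Formula α (k + 1)) : Formula α k

section Interpretation

variable {A : Type u} [Ring A] [StarRing A] [Algebra ℂ A] [Norm A]

/-- Evaluation of a `*`-polynomial at a tuple of elements of a `*`-algebra. -/
def StarPoly.eval {V : Type u} (p : StarPoly V) (v : V → A) : A :=
  FreeAlgebra.lift ℂ (Sum.elim v fun x => star (v x)) p

/-- The interpretation of a formula in a normed `*`-algebra `A` with a linear functional `τ` (in the
applications: a von Neumann algebra with its operator norm and its trace). The quantifiers range
over the closed unit ball of `A`. -/
def Formula.interp (τ : A →ₗ[ℂ] ℂ) {α : Type u} (v : α → A) :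
    {k : ℕ} → Formula α k → (Fin k → A) → ℝ
  | _, .reTr p, z => (τ (p.eval (Sum.elim v z))).re
  | _, .imTr p, z => (τ (p.eval (Sum.elim v z))).im
  | _, .conn f φ, z => f fun i => (φ i).interp τ v z
  | _, .sup φ, z => ⨆ y : {y : A // ‖y‖ ≤ 1}, φ.interp τ v (Fin.snoc z y.1)
  | _, .inf φ, z => ⨅ y : {y : A // ‖y‖ ≤ 1}, φ.interp τ v (Fin.snoc z y.1)

/-- The value `φ(x_1, …, x_n, (a)_{a ∈ S})` of a formula with free variables in
`{x_1, …, x_n} ∪ {y_a}_{a ∈ S}`, the variable `y_a` being interpreted by `a`. -/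
def Formula.value (τ : A →ₗ[ℂ] ℂ) {S : Set A} {n : ℕ} (φ : Formula (Fin n ⊕ S) 0) (x : Fin n → A) :
    ℝ :=
  φ.interp τ (Sum.elim x fun a => a.1) Fin.elim0

/-- `Γ` is satisfiable in `(A, τ)`. -/
def IsSatisfiable (τ : A →ₗ[ℂ] ℂ) {S : Set A} {n : ℕ} (Γ : Set (Formula (Fin n ⊕ S) 0)) : Prop :=
  ∃ x : Fin n → A, (∀ i, ‖x i‖ ≤ 1) ∧ ∀ φ ∈ Γ, φ.value τ x = 0

/-- `Γ` is finitely approximately satisfiable in `(A, τ)`. -/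
def IsFinitelyApproxSatisfiable (τ : A →ₗ[ℂ] ℂ) {S : Set A} {n : ℕ}
    (Γ : Set (Formula (Fin n ⊕ S) 0)) : Prop :=
  ∀ Γ₀ : Set (Formula (Fin n ⊕ S) 0), Γ₀ ⊆ Γ → Γ₀.Finite → ∀ ε : ℝ, 0 < ε →
    ∃ x : Fin n → A, (∀ i, ‖x i‖ ≤ 1) ∧ ∀ φ ∈ Γ₀, |φ.value τ x| < ε

/-- `(A, τ)` is `κ`-saturated. -/
def IsSaturated (τ : A →ₗ[ℂ] ℂ) (κ : Cardinal.{u}) : Prop :=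
  ∀ S : Set A, (∀ a ∈ S, ‖a‖ ≤ 1) → #S < κ → ∀ (n : ℕ) (Γ : Set (Formula (Fin n ⊕ S) 0)),
    IsFinitelyApproxSatisfiable τ Γ → IsSatisfiable τ Γ

/-- `(A, τ)` is countably saturated, i.e. `ℵ₁`-saturated. -/
def IsCountablySaturated (τ : A →ₗ[ℂ] ℂ) : Prop :=
  IsSaturated τ (Cardinal.aleph 1)

end Interpretation

/-! ## Ultrafibers -/

variable {H : Type u} [NormedAddCommGroup H] [InnerProductSpace ℂ H] [CompleteSpace H]

/-- The `*`-algebra of elements of a von Neumann algebra, with the operator norm and the order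
`x ≤ y ↔ y - x` is a positive operator. -/
abbrev Elem (M : VonNeumannAlgebra H) : Type u := M.toStarSubalgebra

/-- The center `Z(M) = M ∩ M'`. -/
def center (M : VonNeumannAlgebra H) : StarSubalgebra ℂ (H →L[ℂ] H) :=
  M.toStarSubalgebra ⊓ M.commutant.toStarSubalgebra

/-- `M` is finite: every isometry in `M` is unitary. -/
def IsFiniteVN (M : VonNeumannAlgebra H) : Prop :=
  ∀ v ∈ M, star v * v = 1 → v * star v = 1

/-- The inclusion of a von Neumann subalgebra `N` of the center of `M` into `M`. -/
def incl {M N : VonNeumannAlgebra H} (hN : N.toStarSubalgebra ≤ center M) (a : Elem N) : Elem M :=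
  ⟨a.1, (hN a.2).1⟩

/-- Normal, faithful, tracial conditional expectations `E : M → N` onto a von Neumann subalgebra `N`
of the center of `M`. -/
structure CentralExpectation (M N : VonNeumannAlgebra H) (hN : N.toStarSubalgebra ≤ center M) where
  /-- the underlying linear map -/
  toLin : Elem M →ₗ[ℂ] Elem N
  map_nonneg : ∀ x : Elem M, 0 ≤ x → 0 ≤ toLin x
  map_incl : ∀ a : Elem N, toLin (incl hN a) = a
  map_incl_mul : ∀ (a : Elem N) (x : Elem M), toLin (incl hN a * x) = a * toLin x
  map_mul_incl : ∀ (x : Elem M) (a : Elem N), toLin (x * incl hN a) = toLin x * a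
  tracial : ∀ x y : Elem M, toLin (x * y) = toLin (y * x)
  faithful : ∀ x : Elem M, toLin (star x * x) = 0 → x = 0
  /-- normality: suprema of bounded increasing nets of self-adjoint elements are preserved -/
  normal : ∀ (S : Set (Elem M)) (x : Elem M), S.Nonempty → (∀ s ∈ S, IsSelfAdjoint s) →
    DirectedOn (· ≤ ·) S → IsLUB S x → IsLUB (toLin '' S) (toLin x)

/-- A character `U` on `N` (a unital, i.e. nonzero, multiplicative linear functional) is countably
incomplete: there are projections `p_n ↘ 0` in `N` with `U(p_n) = 1` for all `n`. -/
def IsCountablyIncomplete {N : VonNeumannAlgebra H} (U : Elem N →ₐ[ℂ] ℂ) : Prop :=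
  ∃ p : ℕ → Elem N, (∀ n, IsStarProjection (p n)) ∧ Antitone p ∧ IsGLB (Set.range p) 0 ∧
    ∀ n, U (p n) = 1

/-- Characters are positive. -/
theorem character_nonneg {N : VonNeumannAlgebra H} (U : Elem N →ₐ[ℂ] ℂ) {a : Elem N} (ha : 0 ≤ a) :
    0 ≤ U a := by
  have h1 : U a ∈ spectrum ℂ a := AlgHom.apply_mem_spectrum U a
  have h2 : U a ∈ spectrum ℂ (a : H →L[ℂ] H) := by
    rw [spectrum.mem_iff] at h1 ⊢
    contrapose! h1
    obtain ⟨w, hw⟩ := h1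
    have hmem : (algebraMap ℂ (H →L[ℂ] H) (U a) - (a : H →L[ℂ] H)) ∈ N :=
      (algebraMap ℂ (Elem N) (U a) - a).2
    have hinv : (w⁻¹ : (H →L[ℂ] H)ˣ).1 ∈ N := by
      rw [← VonNeumannAlgebra.commutant_commutant N, VonNeumannAlgebra.mem_commutant_iff]
      intro g hg
      have hc : g * w.1 = w.1 * g := by
        rw [hw]
        exact ((VonNeumannAlgebra.mem_commutant_iff.1 hg) _ hmem).symm
      exact (Commute.units_inv_right (u := w) hc)
    refine ⟨⟨algebraMap ℂ (Elem N) (U a) - a, ⟨_, hinv⟩, ?_, ?_⟩, rfl⟩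
    · apply Subtype.ext
      change (algebraMap ℂ (H →L[ℂ] H) (U a) - (a : H →L[ℂ] H)) * (w⁻¹ : (H →L[ℂ] H)ˣ).1 = 1
      rw [← hw]; simp
    · apply Subtype.ext
      change (w⁻¹ : (H →L[ℂ] H)ˣ).1 * (algebraMap ℂ (H →L[ℂ] H) (U a) - (a : H →L[ℂ] H)) = 1
      rw [← hw]; simp
  have h3 : (0 : H →L[ℂ] H) ≤ (a : H →L[ℂ] H) := ha
  exact spectrum_nonneg_of_nonneg h3 h2

section Ultrafiber

variable {M N : VonNeumannAlgebra H} {hN : N.toStarSubalgebra ≤ center M}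
  (E : CentralExpectation M N hN) (U : Elem N →ₐ[ℂ] ℂ)

/-- The tracial positive functional `x ↦ U(E(x))` on `M`. -/
def fiberState : Elem M →ₗ[ℂ] ℂ := U.toLinearMap ∘ₗ E.toLin

theorem fiberState_nonneg {x : Elem M} (hx : 0 ≤ x) : 0 ≤ fiberState E U x :=
  character_nonneg U (E.map_nonneg x hx)

theorem fiberState_comm (x y : Elem M) : fiberState E U (x * y) = fiberState E U (y * x) :=
  congrArg U (E.tracial x y)

theorem star_mul_self_nonneg' (x : Elem M) : 0 ≤ star x * x :=
  star_mul_self_nonneg (x : H →L[ℂ] H)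

theorem fiberState_eq_zero_of_le {x y : Elem M} (hx : 0 ≤ x) (hxy : x ≤ y)
    (hy : fiberState E U y = 0) : fiberState E U x = 0 := by
  have h : 0 ≤ y - x := sub_nonneg.2 (show (x : H →L[ℂ] H) ≤ y from hxy)
  have h1 := fiberState_nonneg E U h
  rw [map_sub, hy, zero_sub, neg_nonneg] at h1
  exact le_antisymm h1 (fiberState_nonneg E U hx)

/-- The ideal `I_{E,U} = {x ∈ M : U(E(x^* x)) = 0}`. -/
def fiberIdeal : Ideal (Elem M) where
  carrier := {x | fiberState E U (star x * x) = 0}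
  zero_mem' := by simp
  add_mem' := by
    intro x y hx hy
    simp only [Set.mem_ofPred_eq] at hx hy ⊢
    refine fiberState_eq_zero_of_le E U (star_mul_self_nonneg' _)
      (y := (2 : ℂ) • (star x * x) + (2 : ℂ) • (star y * y)) ?_ (by simp [hx, hy])
    have h := star_mul_self_nonneg ((x : H →L[ℂ] H) - y)
    change star ((x : H →L[ℂ] H) + y) * ((x : H →L[ℂ] H) + y) ≤
      (2 : ℂ) • (star (x : H →L[ℂ] H) * x) + (2 : ℂ) • (star (y : H →L[ℂ] H) * y)
    rw [← sub_nonneg]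
    convert h using 1
    simp only [star_add, star_sub, two_smul]
    noncomm_ring
  smul_mem' := by
    intro a x hx
    simp only [Set.mem_ofPred_eq, smul_eq_mul] at hx ⊢
    refine fiberState_eq_zero_of_le E U (star_mul_self_nonneg' _)
      (y := ((‖star (a : H →L[ℂ] H) * a‖ : ℝ) : ℂ) • (star x * x)) ?_ (by simp [hx])
    have h := CStarAlgebra.star_left_conjugate_le_norm_smul (a := (x : H →L[ℂ] H))
      (b := star (a : H →L[ℂ] H) * a) (IsSelfAdjoint.star_mul_self _)
    change star ((a : H →L[ℂ] H) * x) * ((a : H →L[ℂ] H) * x) ≤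
      ((‖star (a : H →L[ℂ] H) * a‖ : ℝ) : ℂ) • (star (x : H →L[ℂ] H) * x)
    rw [Complex.coe_smul]
    convert h using 1
    simp only [star_mul]
    noncomm_ring

theorem mem_fiberIdeal {x : Elem M} : x ∈ fiberIdeal E U ↔ U (E.toLin (star x * x)) = 0 := Iff.rfl

theorem star_mem_fiberIdeal {x : Elem M} (hx : x ∈ fiberIdeal E U) : star x ∈ fiberIdeal E U := by
  rw [mem_fiberIdeal] at hx ⊢
  rwa [star_star, E.tracial]

instance : (fiberIdeal E U).IsTwoSided where
  mul_mem_of_left := by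
    intro x b hx
    have h := star_mem_fiberIdeal E U
      ((fiberIdeal E U).mul_mem_left (star b) (star_mem_fiberIdeal E U hx))
    simpa using h

theorem fiberState_eq_zero {x : Elem M} (hx : x ∈ fiberIdeal E U) : fiberState E U x = 0 := by
  have hx' : fiberState E U (star x * x) = 0 := hx
  set f := fiberState E U with hf
  have key : ∀ c : ℂ, 0 ≤ star c * f x + c * f (star x) + star c * c * f 1 := by
    intro c
    have h := fiberState_nonneg E U (star_mul_self_nonneg' (x + c • (1 : Elem M)))
    have e : star (x + c • (1 : Elem M)) * (x + c • (1 : Elem M)) =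
        star x * x + (star c • x + c • star x + (star c * c) • (1 : Elem M)) := by
      simp only [star_add, star_smul, star_one, add_mul, mul_add, smul_mul_assoc, mul_smul_comm,
        one_mul, mul_one, smul_add, smul_smul]
      rw [mul_comm c]
      abel
    rw [e, ← hf, map_add, hx', zero_add] at h
    simpa using h
  have hone : f 1 = 1 := by
    have : E.toLin 1 = 1 := E.map_incl 1
    simp [hf, fiberState, this]
  have h1 := (Complex.le_def.1 (key 1)).2
  have h2 := (Complex.le_def.1 (key Complex.I)).2
  have h3 := (Complex.le_def.1 (key (-f x))).1
  simp [hone] at h1 h2 h3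
  have e1 : (f (star x)).re = (f x).re := by linarith
  have e2 : (f (star x)).im = -(f x).im := by linarith
  rw [e1, e2] at h3
  have e3 : (f x).re = 0 := by nlinarith [mul_self_nonneg (f x).re, mul_self_nonneg (f x).im]
  have e4 : (f x).im = 0 := by nlinarith [mul_self_nonneg (f x).re, mul_self_nonneg (f x).im]
  exact Complex.ext e3 e4

/-- The ultrafiber `M^{/E,U} = M / I_{E,U}`, with its quotient `*`-algebra structure and the
quotient of the operator norm. -/
abbrev Ultrafiber : Type u := Elem M ⧸ fiberIdeal E U

instance : StarRing (Ultrafiber E U) where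
  star q := Quotient.liftOn' q (fun x => Ideal.Quotient.mk (fiberIdeal E U) (star x)) (by
    intro x y h
    rw [Submodule.quotientRel_def] at h
    apply Ideal.Quotient.eq.2
    rw [← star_sub]
    exact star_mem_fiberIdeal E U h)
  star_involutive := by
    rintro ⟨x⟩
    exact congrArg (Ideal.Quotient.mk (fiberIdeal E U)) (star_star x)
  star_mul := by
    rintro ⟨x⟩ ⟨y⟩
    exact congrArg (Ideal.Quotient.mk (fiberIdeal E U)) (star_mul x y)
  star_add := by
    rintro ⟨x⟩ ⟨y⟩
    exact congrArg (Ideal.Quotient.mk (fiberIdeal E U)) (star_add x y)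

/-- The trace `τ_{E,U}(x + I_{E,U}) = U(E(x))` on the ultrafiber. -/
def ultrafiberTrace : Ultrafiber E U →ₗ[ℂ] ℂ where
  toFun q := Quotient.liftOn' q (fun x => U (E.toLin x)) (by
    intro x y h
    rw [Submodule.quotientRel_def] at h
    have := fiberState_eq_zero E U h
    rw [map_sub, sub_eq_zero] at this
    exact this)
  map_add' := by
    rintro ⟨x⟩ ⟨y⟩
    exact (fiberState E U).map_add x y
  map_smul' := by
    rintro c ⟨x⟩
    exact (fiberState E U).map_smul c x

theorem star_mk (x : Elem M) : star (Ideal.Quotient.mk (fiberIdeal E U) x) =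
    Ideal.Quotient.mk (fiberIdeal E U) (star x) := rfl

theorem ultrafiberTrace_mk (x : Elem M) :
    ultrafiberTrace E U (Ideal.Quotient.mk (fiberIdeal E U) x) = U (E.toLin x) := rfl

end Ultrafiber

end TracialModelTheory

end

universe u

namespace TracialModelTheory

/-! ### Projections and characters of the central subalgebra -/

section VonNeumann

variable {H : Type u} [NormedAddCommGroup H] [InnerProductSpace ℂ H] [CompleteSpace H]
  {M N : VonNeumannAlgebra H}

/-! Treat all ultrafibers at once. The characters `V` of `N`, with the clopen basis `{V | V e = 1}`
given by projections `e`, form the Stone space of `N`, and a tuple in the unit ball of `M` is a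
section over it. Elements of the unit ball of a fiber lift to the unit ball of `M`
(`exists_lift_norm_le_one`), so a formula in the fiber at `V` can be evaluated upstairs on `M` with
the functional `V ∘ E` (`interp_fiberMk`).

The analogue of Łoś's theorem is `continuous_interp`: for a fixed tuple, the value of a formula is
continuous in `V`. The hard case is a quantifier. A supremum of continuous functions is lower
semicontinuous for free; upper semicontinuity holds because witnesses that are good on orthogonal
central projections can be glued into one element of the unit ball (`exists_glue`).

For saturation, take approximate solutions `x_m` at `U`. By continuity each stays good on a
projection `g_m` with `U g_m = 1`. Intersecting these with the `p_m` of countable incompleteness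
gives a decreasing sequence `h_m` with infimum zero; gluing `x_m` along `h_m - h_{m+1}` gives one
tuple, and continuity at `U` forces its values there to vanish (`exists_common_zero`). This treats
countably many formulas. An arbitrary set of formulas over countably many parameters reduces to that
case because it has a countable uniformly dense subset (`exists_countable_dense_subset`). -/

theorem isClosed_toStarSubalgebra (M : VonNeumannAlgebra H) :
    IsClosed (M.toStarSubalgebra : Set (H →L[ℂ] H)) := by
  rw [VonNeumannAlgebra.coe_toStarSubalgebra, ← VonNeumannAlgebra.centralizer_centralizer]
  exact Set.isClosed_centralizer _

/-- The C*-algebra structure of a von Neumann algebra. -/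
noncomputable abbrev cstarAlgebraElem (M : VonNeumannAlgebra H) : CStarAlgebra (Elem M) :=
  StarSubalgebra.cstarAlgebra M.toStarSubalgebra (h_closed := isClosed_toStarSubalgebra M)

attribute [local instance] cstarAlgebraElem

theorem incl_mul_comm (hN : N.toStarSubalgebra ≤ center M) (a : Elem N) (x : Elem M) :
    incl hN a * x = x * incl hN a :=
  Subtype.ext (((VonNeumannAlgebra.mem_commutant_iff.1 (hN a.2).2) _ x.2).symm)

theorem elem_mul_comm (hN : N.toStarSubalgebra ≤ center M) (a b : Elem N) : a * b = b * a :=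
  Subtype.ext (congrArg (fun x : Elem M => (x : H →L[ℂ] H)) (incl_mul_comm hN a (incl hN b)))

theorem character_star (V : Elem N →ₐ[ℂ] ℂ) (a : Elem N) : V (star a) = star (V a) :=
  map_star V a

/-- The kernel projection of an element of a von Neumann algebra belongs to the algebra. -/
theorem exists_ker_projection (g : Elem N) :
    ∃ p : Elem N, IsStarProjection p ∧ g * p = 0 ∧ ∀ k : Elem N, g * k = 0 → p * k = k := by
  let K : Submodule ℂ H := (g : H →L[ℂ] H).ker
  have hK : IsClosed (K : Set H) := (g : H →L[ℂ] H).isClosed_ker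
  have : CompleteSpace K := hK.completeSpace_coe
  have hp : IsStarProjection K.starProjection := isStarProjection_starProjection
  have hmem : K.starProjection ∈ N := by
    -- The commutant of `N` commutes with `g`, so it leaves the kernel of `g` invariant.
    rw [VonNeumannAlgebra.IsStarProjection.mem_iff hp]
    intro y hy
    rw [Submodule.range_starProjection, Module.End.mem_invtSubmodule]
    intro ξ hξ
    have hc := VonNeumannAlgebra.mem_commutant_iff.1 hy _ g.2
    have h1 : (g : H →L[ℂ] H) ξ = 0 := hξ
    change (g : H →L[ℂ] H) (y ξ) = 0
    have := congrArg (fun T : H →L[ℂ] H => T ξ) hc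
    simpa [h1] using this
  refine ⟨⟨K.starProjection, hmem⟩, ⟨?_, ?_⟩, ?_, ?_⟩
  · exact Subtype.ext hp.isIdempotentElem
  · exact Subtype.ext hp.isSelfAdjoint
  · apply Subtype.ext
    ext ξ
    exact (K.starProjection_apply_mem ξ : K.starProjection ξ ∈ K)
  · intro k hk
    apply Subtype.ext
    ext ξ
    change K.starProjection ((k : H →L[ℂ] H) ξ) = (k : H →L[ℂ] H) ξ
    rw [Submodule.starProjection_eq_self_iff]
    exact congrArg (fun T : Elem N => (T : H →L[ℂ] H) ξ) hk

theorem character_cfc (V : Elem N →ₐ[ℂ] ℂ) (f : ℝ → ℝ) (hf : Continuous f) (a : Elem N)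
    (ha : IsSelfAdjoint a) : V (cfc f a) = (f (V a).re : ℂ) := by
  have hre : ((V a).re : ℂ) = V a := by
    have := character_star V a
    rw [ha.star_eq] at this
    exact Complex.conj_eq_iff_re.1 this.symm
  have hcont : Continuous V := map_continuous V
  let W : Elem N →⋆ₐ[ℂ] ℂ := { V with map_star' := character_star V }
  have h := StarAlgHom.map_cfc (S := ℂ) (R := ℝ) W f a (hf.continuousOn) hcont ha
    (ha.map W)
  have h2 : W a = algebraMap ℝ ℂ (V a).re := hre.symm
  rw [h2, cfc_algebraMap] at h
  exact h

/-- Here `e` is the support projection of `g(a)`, for a bump `g` around `V₀ a`. Since `V₀ (g(a)) ≠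
0`, `V₀ e = 1`; a function `k` of `a` with `g k = 0` is killed by `e`, so `V e = 1` forces `k (V a)
= 0`. This makes evaluation at `a` continuous for the topology given by projections. -/
theorem exists_projection_near (V₀ : Elem N →ₐ[ℂ] ℂ) (a : Elem N) (ha : IsSelfAdjoint a)
    {ε : ℝ} (hε : 0 < ε) : ∃ e : Elem N, IsStarProjection e ∧ V₀ e = 1 ∧
      ∀ V : Elem N →ₐ[ℂ] ℂ, V e = 1 → |(V a).re - (V₀ a).re| ≤ ε := by
  set t := (V₀ a).re with ht
  let g : ℝ → ℝ := fun s => max (ε - |s - t|) 0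
  let k : ℝ → ℝ := fun s => max (|s - t| - ε) 0
  have hg : Continuous g := by fun_prop
  have hk : Continuous k := by fun_prop
  have hgk : cfc g a * cfc k a = 0 := by
    rw [← cfc_mul g k a hg.continuousOn hk.continuousOn]
    convert cfc_const_zero ℝ a with s
    rcases le_total ε |s - t| with h | h
    · simp [g, h]
    · simp [k, h]
  obtain ⟨p, hp, hp1, hp2⟩ := exists_ker_projection (cfc g a)
  refine ⟨1 - p, hp.one_sub, ?_, ?_⟩
  · have h := congrArg V₀ hp1
    rw [map_mul, map_zero, character_cfc V₀ g hg a ha] at h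
    have : g (V₀ a).re = ε := by simp [g, ← ht, hε.le]
    rw [this] at h
    have h0 : V₀ p = 0 := by
      rcases mul_eq_zero.1 h with h | h
      · exact absurd h (by exact_mod_cast hε.ne')
      · exact h
    simp [h0]
  · intro V hV
    have h0 : V p = 0 := by simpa using hV
    have h := congrArg V (hp2 _ hgk)
    rw [map_mul, h0, zero_mul, character_cfc V k hk a ha] at h
    have h' : k (V a).re = 0 := by exact_mod_cast h.symm
    have := le_max_left (|(V a).re - t| - ε) 0
    have h'' : max (|(V a).re - t| - ε) 0 = 0 := h'
    linarith

/-- A nonzero projection has `1` in its spectrum, and in a commutative C*-algebra every spectral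
value is attained by a character. -/
theorem exists_character_eq_one (hN : N.toStarSubalgebra ≤ center M) {e : Elem N}
    (he : IsStarProjection e) (h0 : e ≠ 0) : ∃ V : Elem N →ₐ[ℂ] ℂ, V e = 1 := by
  let _ : NormedCommRing (Elem N) :=
    { (inferInstance : NormedRing (Elem N)) with mul_comm := elem_mul_comm hN }
  have hs : (1 : ℂ) ∈ spectrum ℂ e := by
    rw [spectrum.mem_iff]
    intro hu
    apply h0
    have h1 : (algebraMap ℂ (Elem N) 1 - e) * e = 0 := by
      rw [map_one, sub_mul, one_mul, he.isIdempotentElem.eq, sub_self]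
    exact (hu.mul_right_eq_zero).1 h1
  obtain ⟨f, hf⟩ := WeakDual.CharacterSpace.mem_spectrum_iff_exists.1 hs
  exact ⟨WeakDual.CharacterSpace.toAlgHom f, hf⟩

theorem isStarProjection_mul (hN : N.toStarSubalgebra ≤ center M) {e f : Elem N}
    (he : IsStarProjection e) (hf : IsStarProjection f) : IsStarProjection (e * f) := by
  refine ⟨?_, ?_⟩
  · have := elem_mul_comm hN e f
    exact he.isIdempotentElem.mul_of_commute this hf.isIdempotentElem
  · rw [IsSelfAdjoint, star_mul, he.isSelfAdjoint.star_eq, hf.isSelfAdjoint.star_eq,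
      elem_mul_comm hN]

end VonNeumann

/-! ### Gluing along orthogonal central projections -/

section Glue

variable {H : Type u} [NormedAddCommGroup H] [InnerProductSpace ℂ H] [CompleteSpace H]
  {M N : VonNeumannAlgebra H}

theorem inner_starProjection_apply {e : H →L[ℂ] H} (he : IsStarProjection e) (ξ η : H) :
    inner ℂ (e ξ) η = inner ℂ ξ (e η) := by
  rw [← ContinuousLinearMap.adjoint_inner_left, ← ContinuousLinearMap.star_eq_adjoint,
    he.isSelfAdjoint.star_eq]

theorem orthogonalFamily_range {ι : Type*} {e : ι → H →L[ℂ] H}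
    (he : ∀ i, IsStarProjection (e i)) (hort : ∀ i j, i ≠ j → e i * e j = 0) :
    OrthogonalFamily ℂ (fun i => (e i).range) fun i => (e i).range.subtypeₗᵢ := by
  rintro i j hij ⟨_, ξ, rfl⟩ ⟨_, η, rfl⟩
  change inner ℂ (e i ξ) (e j η) = 0
  rw [inner_starProjection_apply (he i)]
  have h := congrArg (fun T : H →L[ℂ] H => T η) (hort i j hij)
  change e i (e j η) = 0 at h
  rw [h, inner_zero_right]

/-- Bessel's inequality: the left side equals both `‖∑ e i ξ‖ ^ 2` and `⟪∑ e i ξ, ξ⟫`, and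
Cauchy–Schwarz applies to the latter. -/
theorem sum_norm_sq_projection_le {ι : Type*} {e : ι → H →L[ℂ] H}
    (he : ∀ i, IsStarProjection (e i)) (hort : ∀ i j, i ≠ j → e i * e j = 0) (s : Finset ι)
    (ξ : H) : ∑ i ∈ s, ‖e i ξ‖ ^ 2 ≤ ‖ξ‖ ^ 2 := by
  have hsum := (orthogonalFamily_range he hort).norm_sum (fun i => ⟨e i ξ, ξ, rfl⟩) s
  change ‖∑ i ∈ s, e i ξ‖ ^ 2 = ∑ i ∈ s, ‖e i ξ‖ ^ 2 at hsum
  have hterm : ∀ i, ((‖e i ξ‖ ^ 2 : ℝ) : ℂ) = inner ℂ (e i ξ) ξ := by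
    intro i
    have h1 : e i (e i ξ) = e i ξ :=
      congrArg (fun T : H →L[ℂ] H => T ξ) (he i).isIdempotentElem
    have h2 := inner_self_eq_norm_sq_to_K (𝕜 := ℂ) (e i ξ)
    rw [← inner_starProjection_apply (he i), h1] at h2
    rw [Complex.ofReal_pow]
    exact h2.symm
  have hA : ((∑ i ∈ s, ‖e i ξ‖ ^ 2 : ℝ) : ℂ) = inner ℂ (∑ i ∈ s, e i ξ) ξ := by
    rw [sum_inner, Complex.ofReal_sum]
    exact Finset.sum_congr rfl fun i _ => hterm i
  have hle : ∑ i ∈ s, ‖e i ξ‖ ^ 2 ≤ ‖∑ i ∈ s, e i ξ‖ * ‖ξ‖ := by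
    calc ∑ i ∈ s, ‖e i ξ‖ ^ 2 = ‖((∑ i ∈ s, ‖e i ξ‖ ^ 2 : ℝ) : ℂ)‖ := by
          rw [Complex.norm_real, Real.norm_of_nonneg (by positivity)]
      _ ≤ _ := by rw [hA]; exact norm_inner_le_norm _ _
  rw [← hsum] at hle ⊢
  nlinarith [norm_nonneg ξ, norm_nonneg (∑ i ∈ s, e i ξ),
    sq_nonneg (‖∑ i ∈ s, e i ξ‖ - ‖ξ‖)]

/-- Elements of the unit ball can be glued along a family of orthogonal central projections. -/
theorem exists_glue (hN : N.toStarSubalgebra ≤ center M) {ι : Type*} (e : ι → Elem N)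
    (he : ∀ i, IsStarProjection (e i)) (hort : ∀ i j, i ≠ j → e i * e j = 0)
    (y : ι → Elem M) (hy : ∀ i, ‖y i‖ ≤ 1) :
    ∃ Y : Elem M, ‖Y‖ ≤ 1 ∧ ∀ i, incl hN (e i) * Y = incl hN (e i) * y i := by
  let f : ι → H →L[ℂ] H := fun i => e i
  let w : ι → H →L[ℂ] H := fun i => y i
  have hf : ∀ i, IsStarProjection (f i) := fun i =>
    ⟨congrArg (fun x : Elem N => (x : H →L[ℂ] H)) (he i).isIdempotentElem,
      congrArg (fun x : Elem N => (x : H →L[ℂ] H)) (he i).isSelfAdjoint⟩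
  have hfo : ∀ i j, i ≠ j → f i * f j = 0 := fun i j hij =>
    congrArg (fun x : Elem N => (x : H →L[ℂ] H)) (hort i j hij)
  have hcomm : ∀ (i j) (ξ : H), f i (w j ξ) = w j (f i ξ) := fun i j ξ =>
    congrArg (fun x : Elem M => (x : H →L[ℂ] H) ξ) (incl_mul_comm hN (e i) (y j))
  have hw : ∀ i (ξ : H), ‖w i ξ‖ ≤ ‖ξ‖ := fun i ξ => by
    have := (w i).le_of_opNorm_le (hy i) ξ
    rwa [one_mul] at this
  have hV := orthogonalFamily_range hf hfo
  let l : H → ∀ i, (f i).range := fun ξ i => ⟨w i (f i ξ), w i ξ, hcomm i i ξ⟩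
  have hbound : ∀ ξ (s : Finset ι), ∑ i ∈ s, ‖w i (f i ξ)‖ ^ 2 ≤ ‖ξ‖ ^ 2 := fun ξ s =>
    (Finset.sum_le_sum fun i _ => pow_le_pow_left₀ (norm_nonneg _) (hw i _) 2).trans
      (sum_norm_sq_projection_le hf hfo s ξ)
  have hsummable : ∀ ξ, Summable fun i => w i (f i ξ) := fun ξ => by
    refine (hV.summable_iff_norm_sq_summable (l ξ)).2 ?_
    exact summable_of_sum_le (fun i => by positivity) (hbound ξ)
  -- The glued element is the strongly convergent sum of the `y i * e i`. Its terms at `ξ` are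
  -- orthogonal and `‖y i‖ ≤ 1`, so Bessel gives both convergence and the bound `1`.
  let T : H →ₗ[ℂ] H :=
    { toFun := fun ξ => ∑' i, w i (f i ξ)
      map_add' := fun ξ η => by
        simp only [map_add]
        exact (hsummable ξ).tsum_add (hsummable η)
      map_smul' := fun c ξ => by
        simp only [map_smul]
        exact (hsummable ξ).tsum_const_smul c }
  have hT : ∀ ξ, ‖T ξ‖ ≤ 1 * ‖ξ‖ := fun ξ => by
    rw [one_mul]
    refine le_of_tendsto (hsummable ξ).hasSum.norm (Filter.Eventually.of_forall fun s => ?_)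
    have h1 := hV.norm_sum (l ξ) s
    have h2 := hbound ξ s
    change ‖∑ i ∈ s, w i (f i ξ)‖ ^ 2 = ∑ i ∈ s, ‖w i (f i ξ)‖ ^ 2 at h1
    rw [← h1] at h2
    exact le_of_sq_le_sq h2 (norm_nonneg _)
  have hmem : T.mkContinuous 1 hT ∈ M := by
    -- Strong sums stay in `M` by the bicommutant theorem: each term commutes with the commutant.
    rw [← VonNeumannAlgebra.commutant_commutant M, VonNeumannAlgebra.mem_commutant_iff]
    intro c hc
    have hc' := VonNeumannAlgebra.mem_commutant_iff.1 hc
    ext ξ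
    change c (∑' i, w i (f i ξ)) = ∑' i, w i (f i (c ξ))
    rw [c.map_tsum (hsummable ξ)]
    refine tsum_congr fun i => ?_
    have h1 := congrArg (fun x : H →L[ℂ] H => x (f i ξ)) (hc' (w i) (y i).2)
    have h2 := congrArg (fun x : H →L[ℂ] H => x ξ) (hc' (f i) (incl hN (e i)).2)
    change w i (c (f i ξ)) = c (w i (f i ξ)) at h1
    change f i (c ξ) = c (f i ξ) at h2
    rw [← h1, h2]
  refine ⟨⟨T.mkContinuous 1 hT, hmem⟩, T.mkContinuous_norm_le zero_le_one hT, fun j => ?_⟩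
  apply Subtype.ext
  ext ξ
  change f j (∑' i, w i (f i ξ)) = f j (w j ξ)
  rw [(f j).map_tsum (hsummable ξ), tsum_eq_single j]
  · rw [hcomm, hcomm]
    congr 1
    exact congrArg (fun T : H →L[ℂ] H => T ξ) (hf j).isIdempotentElem
  · intro i hij
    rw [hcomm]
    have h := congrArg (fun T : H →L[ℂ] H => T ξ) (hfo j i hij.symm)
    change f j (f i ξ) = 0 at h
    rw [h, map_zero]

end Glue

/-! ### Lifting the unit ball of a fiber -/

section Lifting

attribute [local instance] cstarAlgebraElem

variable {H : Type u} [NormedAddCommGroup H] [InnerProductSpace ℂ H] [CompleteSpace H]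
  {M N : VonNeumannAlgebra H} {hN : N.toStarSubalgebra ≤ center M}
  (E : CentralExpectation M N hN) (V : Elem N →ₐ[ℂ] ℂ)

theorem fiberState_re_nonneg {x : Elem M} (hx : 0 ≤ x) : 0 ≤ (fiberState E V x).re :=
  (Complex.le_def.1 (fiberState_nonneg E V hx)).1

theorem fiberState_eq_of_sub_mem {x y : Elem M} (h : x - y ∈ fiberIdeal E V) :
    fiberState E V x = fiberState E V y := by
  have := fiberState_eq_zero E V h
  rwa [map_sub, sub_eq_zero] at this

theorem fiberState_conjugate_le (b k : Elem M) :
    (fiberState E V (star k * (star b * b) * k)).re ≤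
      ‖b‖ ^ 2 * (fiberState E V (star k * k)).re := by
  have h := CStarAlgebra.star_left_conjugate_le_norm_smul (a := (k : H →L[ℂ] H))
    (b := star (b : H →L[ℂ] H) * b) (IsSelfAdjoint.star_mul_self _)
  have h2 : 0 ≤ ((‖b‖ ^ 2 : ℝ) : ℂ) • (star k * k) - star k * (star b * b) * k := by
    change (0 : H →L[ℂ] H) ≤ ((‖b‖ ^ 2 : ℝ) : ℂ) • (star (k : H →L[ℂ] H) * k) -
      star (k : H →L[ℂ] H) * (star (b : H →L[ℂ] H) * b) * k
    rw [sub_nonneg, Complex.coe_smul]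
    refine h.trans_eq ?_
    rw [CStarRing.norm_star_mul_self, sq]
    rfl
  have h3 := fiberState_re_nonneg E V h2
  rw [map_sub, map_smul, Complex.sub_re, smul_eq_mul, Complex.re_ofReal_mul] at h3
  linarith

theorem fiberState_conjugate_eq {x b : Elem M} (h : x - b ∈ fiberIdeal E V) (k : Elem M) :
    fiberState E V (star k * (star x * x) * k) = fiberState E V (star k * (star b * b) * k) := by
  apply fiberState_eq_of_sub_mem
  have e : star k * (star x * x) * k - star k * (star b * b) * k =
      star k * star x * (x - b) * k + star k * star (x - b) * (b * k) := by
    rw [star_sub]; noncomm_ring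
  rw [e]
  refine (fiberIdeal E V).add_mem ?_ ?_
  · exact (fiberIdeal E V).mul_mem_right _ ((fiberIdeal E V).mul_mem_left _ h)
  · exact (fiberIdeal E V).mul_mem_right _
      ((fiberIdeal E V).mul_mem_left _ (star_mem_fiberIdeal E V h))

theorem exists_lift_norm_lt {x : Elem M} {r : ℝ} (hx : ‖Ideal.Quotient.mk (fiberIdeal E V) x‖ < r) :
    ∃ b : Elem M, ‖b‖ < r ∧ x - b ∈ fiberIdeal E V := by
  have h : ‖(QuotientAddGroup.mk x : Elem M ⧸ (fiberIdeal E V).toAddSubgroup)‖ < r := hx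
  obtain ⟨b, hb, hbr⟩ := QuotientAddGroup.norm_lt_iff.1 h
  refine ⟨b, hbr, ?_⟩
  have := (QuotientAddGroup.eq.1 hb)
  have h2 : -b + x ∈ fiberIdeal E V := this
  rwa [neg_add_eq_sub] at h2

/-- With `a = x* x`, `c = (a - 1)₊` and `s = √c`, one has `s a s = c + c²`. Replacing `x` by a lift
of norm below `r` bounds the value of the functional at `s a s` by `r²` times its value at `c`;
letting `r → 1` kills its value at `c²`. -/
theorem cfc_posPart_mem_fiberIdeal {x : Elem M}
    (hx : ‖Ideal.Quotient.mk (fiberIdeal E V) x‖ ≤ 1) :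
    cfc (fun t : ℝ => max (t - 1) 0) (star x * x) ∈ fiberIdeal E V := by
  set a := star x * x with ha
  let s : ℝ → ℝ := fun t => √(max (t - 1) 0)
  let c : ℝ → ℝ := fun t => max (t - 1) 0
  have hs : Continuous s := by fun_prop
  have hc : Continuous c := by fun_prop
  have hasa : IsSelfAdjoint a := IsSelfAdjoint.star_mul_self x
  have hsa : star (cfc s a) = cfc s a := (cfc_predicate s a : IsSelfAdjoint _).star_eq
  have hca : star (cfc c a) = cfc c a := (cfc_predicate c a : IsSelfAdjoint _).star_eq
  have hss : cfc s a * cfc s a = cfc c a := by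
    rw [← cfc_mul s s a hs.continuousOn hs.continuousOn]
    congr 1
    ext t
    exact Real.mul_self_sqrt (le_max_right _ _)
  have hsas : cfc s a * a * cfc s a = cfc c a + cfc c a * cfc c a := by
    have h1 : cfc (fun t => s t * t * s t) a = cfc s a * a * cfc s a := by
      rw [cfc_mul _ s a (by fun_prop) hs.continuousOn, cfc_mul s _ a hs.continuousOn (by fun_prop),
        cfc_id' ℝ a]
    rw [← h1,
      ← cfc_mul c c a hc.continuousOn hc.continuousOn,
      ← cfc_add a c _ hc.continuousOn (by fun_prop)]
    congr 1
    ext t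
    have h2 : √(max (t - 1) 0) * √(max (t - 1) 0) = max (t - 1) 0 :=
      Real.mul_self_sqrt (le_max_right _ _)
    have h3 : s t * t * s t = max (t - 1) 0 * t := by
      rw [← h2]; simp only [s]; ring
    rw [h3]
    rcases le_total (t - 1) 0 with h | h
    · simp [c, h]
    · simp only [c, max_eq_left h]; ring
  set A := (fiberState E V (cfc c a)).re
  set B := (fiberState E V (cfc c a * cfc c a)).re
  have hA : 0 ≤ A := by
    have := fiberState_re_nonneg E V (star_mul_self_nonneg' (cfc s a))
    rwa [hsa, hss] at this
  have key : ∀ r : ℝ, 1 < r → A + B ≤ r ^ 2 * A := by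
    intro r hr
    obtain ⟨b, hb, hxb⟩ := exists_lift_norm_lt E V (hx.trans_lt hr)
    have h1 := fiberState_conjugate_eq E V hxb (cfc s a)
    have h2 := fiberState_conjugate_le E V b (cfc s a)
    rw [← h1, hsa, hss, ← ha, hsas, map_add, Complex.add_re] at h2
    refine h2.trans (mul_le_mul_of_nonneg_right ?_ hA)
    exact pow_le_pow_left₀ (norm_nonneg _) hb.le 2
  have hB : B ≤ 0 := by
    have ht : Filter.Tendsto (fun r : ℝ => r ^ 2 * A) (nhdsWithin 1 (Set.Ioi 1))
        (nhds ((1 : ℝ) ^ 2 * A)) :=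
      ((continuous_id.pow 2).mul continuous_const).continuousAt.tendsto.mono_left nhdsWithin_le_nhds
    have := ge_of_tendsto ht (Filter.eventually_of_mem self_mem_nhdsWithin key)
    linarith
  have hpos := fiberState_nonneg E V (star_mul_self_nonneg' (cfc c a))
  change fiberState E V (star (cfc c a) * cfc c a) = 0
  rw [hca] at hpos ⊢
  have h2 := Complex.le_def.1 hpos
  exact Complex.ext (le_antisymm hB h2.1) h2.2.symm

/-- Elements of the closed unit ball of an ultrafiber lift to the closed unit ball. -/
theorem exists_lift_norm_le_one {x : Elem M}
    (hx : ‖Ideal.Quotient.mk (fiberIdeal E V) x‖ ≤ 1) :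
    ∃ y : Elem M, ‖y‖ ≤ 1 ∧
      Ideal.Quotient.mk (fiberIdeal E V) y = Ideal.Quotient.mk (fiberIdeal E V) x := by
  have hmem := cfc_posPart_mem_fiberIdeal E V hx
  set a := star x * x with ha
  -- The lift is `x g(x* x)`: `t g(t)² = t / max t 1 ≤ 1` on the spectrum gives the norm bound. The
  -- function `r` is chosen so that `1 - g(t) = r(t) (t - 1)₊`, which puts the correction in the
  -- ideal.
  let g : ℝ → ℝ := fun t => (√(max t 1))⁻¹
  let r : ℝ → ℝ := fun t => (√(max t 1) * (√(max t 1) + 1))⁻¹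
  have hpos : ∀ t : ℝ, 0 < √(max t 1) := fun t => Real.sqrt_pos.2 (by positivity)
  have hg : Continuous g := by
    refine Continuous.inv₀ (by fun_prop) fun t => (hpos t).ne'
  have hr : Continuous r := by
    refine Continuous.inv₀ (by fun_prop) fun t => ?_
    have := hpos t
    positivity
  have hga : star (cfc g a) = cfc g a := (cfc_predicate g a : IsSelfAdjoint _).star_eq
  have hasa : IsSelfAdjoint a := IsSelfAdjoint.star_mul_self x
  refine ⟨x * cfc g a, ?_, ?_⟩
  · have h1 : star (x * cfc g a) * (x * cfc g a) = cfc (fun t => g t * t * g t) a := by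
      rw [cfc_mul _ g a (by fun_prop) hg.continuousOn, cfc_mul g _ a hg.continuousOn (by fun_prop),
        cfc_id' ℝ a, star_mul, hga, ha]
      noncomm_ring
    have h2 : ‖cfc (fun t => g t * t * g t) a‖ ≤ 1 := by
      refine norm_cfc_le zero_le_one fun t ht => ?_
      have ht0 : 0 ≤ t := spectrum_star_mul_self_nonneg t ht
      have h3 : √(max t 1) * √(max t 1) = max t 1 := Real.mul_self_sqrt (by positivity)
      have h4 : g t * t * g t = t / max t 1 := by
        rw [← h3]; simp only [g]; field_simp
      rw [h4, Real.norm_of_nonneg (by positivity)]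
      exact div_le_one_of_le₀ (le_max_left _ _) (by positivity)
    rw [← h1, CStarRing.norm_star_mul_self] at h2
    nlinarith [norm_nonneg (x * cfc g a)]
  · symm
    apply Ideal.Quotient.eq.2
    have h1 : x - x * cfc g a = x * cfc r a * cfc (fun t : ℝ => max (t - 1) 0) a := by
      have h2 : 1 - cfc g a = cfc r a * cfc (fun t : ℝ => max (t - 1) 0) a := by
        rw [← cfc_mul r _ a hr.continuousOn (by fun_prop), ← cfc_const_one ℝ a,
          ← cfc_sub _ g a (by fun_prop) hg.continuousOn]
        congr 1
        ext t
        have hp := hpos t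
        have h3 : √(max t 1) * √(max t 1) = max t 1 := Real.mul_self_sqrt (by positivity)
        have h4 : max (t - 1) 0 = max t 1 - 1 := by
          rw [← max_sub_sub_right, sub_self]
        rw [h4, ← h3]
        simp only [g, r]
        field_simp
        ring
      rw [mul_assoc, ← h2, mul_sub, mul_one]
    rw [h1]
    exact (fiberIdeal E V).mul_mem_left _ hmem

end Lifting

/-! ### Evaluating formulas upstairs -/

section Interp

variable {H : Type u} [NormedAddCommGroup H] [InnerProductSpace ℂ H] [CompleteSpace H]
  {M N : VonNeumannAlgebra H} {hN : N.toStarSubalgebra ≤ center M}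
  (E : CentralExpectation M N hN) (V : Elem N →ₐ[ℂ] ℂ)

/-- The quotient map of a von Neumann algebra onto an ultrafiber. -/
noncomputable abbrev fiberMk (x : Elem M) : Ultrafiber E V := Ideal.Quotient.mk (fiberIdeal E V) x

theorem eval_fiberMk {α : Type u} (p : StarPoly α) (v : α → Elem M) :
    p.eval (fun i => fiberMk E V (v i)) = fiberMk E V (p.eval v) := by
  have h : FreeAlgebra.lift ℂ (Sum.elim (fun i => fiberMk E V (v i))
      fun i => star (fiberMk E V (v i))) =
      (Ideal.Quotient.mkₐ ℂ (fiberIdeal E V)).comp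
        (FreeAlgebra.lift ℂ (Sum.elim v fun i => star (v i))) := by
    apply FreeAlgebra.hom_ext
    funext i
    rcases i with i | i <;> simp [fiberMk, star_mk]
  exact congrArg (fun f => f p) h

theorem norm_fiberMk_le (x : Elem M) : ‖fiberMk E V x‖ ≤ ‖x‖ :=
  QuotientAddGroup.norm_mk_le_norm (S := (fiberIdeal E V).toAddSubgroup) (m := x)

/-- The quotient map between closed unit balls. -/
noncomputable def ballMk (y : {y : Elem M // ‖y‖ ≤ 1}) : {y : Ultrafiber E V // ‖y‖ ≤ 1} :=
  ⟨fiberMk E V y.1, (norm_fiberMk_le E V y.1).trans y.2⟩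

theorem ballMk_surjective : Function.Surjective (ballMk E V) := by
  rintro ⟨y, hy⟩
  obtain ⟨x, rfl⟩ := Ideal.Quotient.mk_surjective y
  obtain ⟨b, hb, h⟩ := exists_lift_norm_le_one E V hy
  exact ⟨⟨b, hb⟩, Subtype.ext h⟩

theorem snoc_fiberMk {k : ℕ} (z : Fin k → Elem M) (y : Elem M) :
    (Fin.snoc (fun i => fiberMk E V (z i)) (fiberMk E V y) : Fin (k + 1) → Ultrafiber E V) =
      fun i => fiberMk E V ((Fin.snoc z y : Fin (k + 1) → Elem M) i) := by
  funext i
  refine Fin.lastCases ?_ (fun j => ?_) i <;> simp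

theorem sumElim_fiberMk {α β : Type*} (v : α → Elem M) (z : β → Elem M) :
    Sum.elim (fun i => fiberMk E V (v i)) (fun i => fiberMk E V (z i)) =
      fun i => fiberMk E V (Sum.elim v z i) := by
  funext i
  rcases i with i | i <;> rfl

/-- Formulas may be evaluated upstairs, with respect to the induced functional. -/
theorem interp_fiberMk {α : Type u} (v : α → Elem M) {k : ℕ} (φ : Formula α k) (z : Fin k → Elem M) :
    φ.interp (ultrafiberTrace E V) (fun i => fiberMk E V (v i)) (fun i => fiberMk E V (z i)) =
      φ.interp (fiberState E V) v z := by
  induction φ with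
  | reTr p =>
    simp only [Formula.interp]
    rw [sumElim_fiberMk, eval_fiberMk]
    rfl
  | imTr p =>
    simp only [Formula.interp]
    rw [sumElim_fiberMk, eval_fiberMk]
    rfl
  | conn f φ ih => simp only [Formula.interp, ih]
  | sup φ ih =>
    simp only [Formula.interp]
    symm
    -- The supremum over the ball of the fiber is reindexed along the surjection from the ball of
    -- `M`.
    refine (ballMk_surjective E V).iSup_congr _ fun y => ?_
    rw [← ih, ← snoc_fiberMk]
    rfl
  | inf φ ih =>
    simp only [Formula.interp]
    symm
    refine (ballMk_surjective E V).iInf_congr _ fun y => ?_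
    rw [← ih, ← snoc_fiberMk]
    rfl

theorem interp_congr {α : Type u} {v v' : α → Elem M} {k : ℕ} (φ : Formula α k)
    {z z' : Fin k → Elem M} (hv : ∀ i, fiberMk E V (v i) = fiberMk E V (v' i))
    (hz : ∀ i, fiberMk E V (z i) = fiberMk E V (z' i)) :
    φ.interp (fiberState E V) v z = φ.interp (fiberState E V) v' z' := by
  rw [← interp_fiberMk, ← interp_fiberMk, funext hv, funext hz]

/-- `V ∘ E` does not change when its argument is multiplied by `e`, because `E` is `N`-linear and `V
e = 1`. So agreement on `e` is enough for agreement in every fiber with `V e = 1`. -/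
theorem fiberMk_eq_of_incl_mul_eq {e : Elem N} (he : V e = 1) {y y' : Elem M}
    (h : incl hN e * y = incl hN e * y') : fiberMk E V y = fiberMk E V y' := by
  apply Ideal.Quotient.eq.2
  rw [mem_fiberIdeal]
  have h0 : incl hN e * (y - y') = 0 := by rw [mul_sub, h, sub_self]
  have h1 : incl hN e * (star (y - y') * (y - y')) = 0 := by
    rw [← mul_assoc, incl_mul_comm, mul_assoc, h0, mul_zero]
  have h2 := congrArg V (E.map_incl_mul e (star (y - y') * (y - y')))
  rw [h1, map_zero, map_zero, map_mul, he, one_mul] at h2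
  exact h2.symm

theorem norm_fiberState_le_of_isSelfAdjoint {a : Elem M} (ha : IsSelfAdjoint a) :
    ‖fiberState E V a‖ ≤ ‖a‖ := by
  have hone : fiberState E V 1 = 1 := by
    have : E.toLin 1 = 1 := E.map_incl 1
    simp [fiberState, this]
  have key : ∀ b : Elem M, IsSelfAdjoint b → 0 ≤ ((‖b‖ : ℝ) : ℂ) - fiberState E V b := by
    intro b hb
    have hb' : IsSelfAdjoint (b : H →L[ℂ] H) :=
      congrArg (fun x : Elem M => (x : H →L[ℂ] H)) hb
    have h1 : 0 ≤ ((‖b‖ : ℝ) : ℂ) • (1 : Elem M) - b := by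
      change (0 : H →L[ℂ] H) ≤ ((‖b‖ : ℝ) : ℂ) • (1 : H →L[ℂ] H) - b
      rw [sub_nonneg, Complex.coe_smul, ← Algebra.algebraMap_eq_smul_one]
      exact hb'.le_algebraMap_norm_self
    have h2 := fiberState_nonneg E V h1
    rwa [map_sub, map_smul, hone, smul_eq_mul, mul_one] at h2
  have h1 := Complex.le_def.1 (key a ha)
  have h2 := Complex.le_def.1 (key (-a) ha.neg)
  rw [norm_neg, map_neg] at h2
  simp at h1 h2
  have h3 : fiberState E V a = ((fiberState E V a).re : ℂ) := Complex.ext rfl (by simp [h1.2])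
  rw [h3, Complex.norm_real, Real.norm_eq_abs, abs_le]
  change -‖(a : H →L[ℂ] H)‖ ≤ _ ∧ _ ≤ ‖(a : H →L[ℂ] H)‖
  constructor <;> linarith [h1.1, h2.1]

/-- The crude factor `2` comes from splitting into real and imaginary parts; only a bound
independent of `V` matters. -/
theorem norm_fiberState_le (a : Elem M) : ‖fiberState E V a‖ ≤ 2 * ‖a‖ := by
  have h := realPart_add_I_smul_imaginaryPart a
  calc ‖fiberState E V a‖
      = ‖fiberState E V (realPart a : Elem M) +
          Complex.I * fiberState E V (imaginaryPart a : Elem M)‖ := by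
        conv_lhs => rw [← h, map_add, map_smul, smul_eq_mul]
    _ ≤ ‖(realPart a : Elem M)‖ + ‖(imaginaryPart a : Elem M)‖ := by
        refine (norm_add_le _ _).trans (add_le_add ?_ ?_)
        · exact norm_fiberState_le_of_isSelfAdjoint E V (realPart a).2
        · rw [norm_mul, Complex.norm_I, one_mul]
          exact norm_fiberState_le_of_isSelfAdjoint E V (imaginaryPart a).2
    _ ≤ ‖a‖ + ‖a‖ := add_le_add (realPart.norm_le a) (imaginaryPart.norm_le a)
    _ = 2 * ‖a‖ := (two_mul _).symm

theorem exists_norm_eval_le (M : VonNeumannAlgebra H) {α : Type u} (p : StarPoly α) :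
    ∃ C : ℝ, 0 ≤ C ∧ ∀ v : α → Elem M, (∀ i, ‖v i‖ ≤ 1) → ‖p.eval v‖ ≤ C := by
  induction p using FreeAlgebra.induction with
  | grade0 r =>
    refine ⟨‖algebraMap ℂ (Elem M) r‖, norm_nonneg _, fun v _ => ?_⟩
    simp [StarPoly.eval]
  | grade1 x =>
    refine ⟨1, zero_le_one, fun v hv => ?_⟩
    rcases x with x | x
    · simpa [StarPoly.eval] using hv x
    · simpa [StarPoly.eval] using hv x
  | mul p q hp hq =>
    obtain ⟨C, hC, h⟩ := hp
    obtain ⟨D, hD, h'⟩ := hq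
    refine ⟨C * D, mul_nonneg hC hD, fun v hv => ?_⟩
    simp only [StarPoly.eval, map_mul]
    exact (norm_mul_le _ _).trans (mul_le_mul (h v hv) (h' v hv) (norm_nonneg _) hC)
  | add p q hp hq =>
    obtain ⟨C, hC, h⟩ := hp
    obtain ⟨D, hD, h'⟩ := hq
    refine ⟨C + D, add_nonneg hC hD, fun v hv => ?_⟩
    simp only [StarPoly.eval, map_add]
    exact (norm_add_le _ _).trans (add_le_add (h v hv) (h' v hv))

instance nonempty_unitBall (M : VonNeumannAlgebra H) : Nonempty {y : Elem M // ‖y‖ ≤ 1} :=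
  ⟨⟨0, by simp⟩⟩

theorem norm_snoc_le {k : ℕ} {z : Fin k → Elem M} (hz : ∀ i, ‖z i‖ ≤ 1) {y : Elem M}
    (hy : ‖y‖ ≤ 1) (i : Fin (k + 1)) : ‖(Fin.snoc z y : Fin (k + 1) → Elem M) i‖ ≤ 1 := by
  refine Fin.lastCases ?_ (fun j => ?_) i
  · simpa using hy
  · simpa using hz j

theorem norm_sumElim_le {α β : Type*} {v : α → Elem M} {z : β → Elem M}
    (hv : ∀ i, ‖v i‖ ≤ 1) (hz : ∀ i, ‖z i‖ ≤ 1) (i : α ⊕ β) : ‖Sum.elim v z i‖ ≤ 1 := by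
  rcases i with i | i
  · exact hv i
  · exact hz i

theorem abs_iSup_le {ι : Type*} [Nonempty ι] {f : ι → ℝ} {C : ℝ} (h : ∀ i, |f i| ≤ C) :
    |⨆ i, f i| ≤ C := by
  obtain ⟨i₀⟩ := ‹Nonempty ι›
  have hb : BddAbove (Set.range f) := ⟨C, by rintro _ ⟨i, rfl⟩; exact (abs_le.1 (h i)).2⟩
  have : Nonempty ι := ⟨i₀⟩
  exact abs_le.2 ⟨(abs_le.1 (h i₀)).1.trans (le_ciSup hb i₀), ciSup_le fun i => (abs_le.1 (h i)).2⟩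

theorem abs_iInf_le {ι : Type*} [Nonempty ι] {f : ι → ℝ} {C : ℝ} (h : ∀ i, |f i| ≤ C) :
    |⨅ i, f i| ≤ C := by
  obtain ⟨i₀⟩ := ‹Nonempty ι›
  have hb : BddBelow (Set.range f) := ⟨-C, by rintro _ ⟨i, rfl⟩; exact (abs_le.1 (h i)).1⟩
  have : Nonempty ι := ⟨i₀⟩
  exact abs_le.2 ⟨le_ciInf fun i => (abs_le.1 (h i)).1, (ciInf_le hb i₀).trans (abs_le.1 (h i₀)).2⟩

/-- Formulas are bounded on the unit ball, uniformly in the character. -/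
theorem exists_abs_interp_le {α : Type u} {k : ℕ} (φ : Formula α k) :
    ∃ C : ℝ, 0 ≤ C ∧ ∀ (V : Elem N →ₐ[ℂ] ℂ) (v : α → Elem M) (z : Fin k → Elem M),
      (∀ i, ‖v i‖ ≤ 1) → (∀ i, ‖z i‖ ≤ 1) → |φ.interp (fiberState E V) v z| ≤ C := by
  induction φ with
  | reTr p =>
    obtain ⟨C, hC, h⟩ := exists_norm_eval_le M p
    refine ⟨2 * C, by positivity, fun V v z hv hz => ?_⟩
    refine (Complex.abs_re_le_norm _).trans ((norm_fiberState_le E V _).trans ?_)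
    exact mul_le_mul_of_nonneg_left (h _ (norm_sumElim_le hv hz)) zero_le_two
  | imTr p =>
    obtain ⟨C, hC, h⟩ := exists_norm_eval_le M p
    refine ⟨2 * C, by positivity, fun V v z hv hz => ?_⟩
    refine (Complex.abs_im_le_norm _).trans ((norm_fiberState_le E V _).trans ?_)
    exact mul_le_mul_of_nonneg_left (h _ (norm_sumElim_le hv hz)) zero_le_two
  | conn f φ ih =>
    choose C hC h using ih
    obtain ⟨D, hD⟩ := (isCompact_univ_pi fun i => isCompact_Icc (a := -C i) (b := C i)
      ).exists_bound_of_continuousOn f.continuous.continuousOn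
    refine ⟨max D 0, le_max_right _ _, fun V v z hv hz => ?_⟩
    refine (hD _ fun i _ => ?_).trans (le_max_left _ _)
    exact Set.mem_Icc.2 (abs_le.1 (h i V v z hv hz))
  | sup φ ih =>
    obtain ⟨C, hC, h⟩ := ih
    exact ⟨C, hC, fun V v z hv hz => abs_iSup_le fun y => h V v _ hv (norm_snoc_le hz y.2)⟩
  | inf φ ih =>
    obtain ⟨C, hC, h⟩ := ih
    exact ⟨C, hC, fun V v z hv hz => abs_iInf_le fun y => h V v _ hv (norm_snoc_le hz y.2)⟩

end Interp

/-! ### Continuity of formulas in the character -/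

section Continuity

variable {H : Type u} [NormedAddCommGroup H] [InnerProductSpace ℂ H] [CompleteSpace H]
  {M N : VonNeumannAlgebra H}

/-- The topology on the characters of `N` generated by the sets `{V | V e = 1}`, `e` a projection. -/
instance characterTopology (N : VonNeumannAlgebra H) : TopologicalSpace (Elem N →ₐ[ℂ] ℂ) :=
  TopologicalSpace.generateFrom {s | ∃ e : Elem N, IsStarProjection e ∧ s = {V | V e = 1}}

theorem isOpen_character_eq_one {e : Elem N} (he : IsStarProjection e) :
    IsOpen {V : Elem N →ₐ[ℂ] ℂ | V e = 1} :=
  TopologicalSpace.isOpen_generateFrom_of_mem ⟨e, he, rfl⟩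

theorem character_eq_one_of_mul {e f : Elem N} (he : IsStarProjection e) (hf : IsStarProjection f)
    {V : Elem N →ₐ[ℂ] ℂ} (h : V (e * f) = 1) : V e = 1 ∧ V f = 1 := by
  rw [map_mul] at h
  have h1 : V e * V e = V e := by rw [← map_mul, he.isIdempotentElem.eq]
  have h2 : V f * V f = V f := by rw [← map_mul, hf.isIdempotentElem.eq]
  exact ⟨mul_right_cancel₀ (left_ne_zero_of_mul_eq_one h) (h1.trans (one_mul _).symm),
    mul_right_cancel₀ (right_ne_zero_of_mul_eq_one h) (h2.trans (one_mul _).symm)⟩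

theorem isTopologicalBasis_characters (hN : N.toStarSubalgebra ≤ center M) :
    TopologicalSpace.IsTopologicalBasis
      {s : Set (Elem N →ₐ[ℂ] ℂ) | ∃ e : Elem N, IsStarProjection e ∧ s = {V | V e = 1}} where
  exists_subset_inter := by
    rintro _ ⟨e, he, rfl⟩ _ ⟨f, hf, rfl⟩ V ⟨hV, hV'⟩
    have hV : V e = 1 := hV
    have hV' : V f = 1 := hV'
    refine ⟨_, ⟨e * f, isStarProjection_mul hN he hf, rfl⟩, ?_, fun W hW =>
      character_eq_one_of_mul he hf hW⟩
    simp [hV, hV']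
  sUnion_eq := by
    refine Set.eq_univ_of_forall fun V => ⟨_, ⟨1, IsStarProjection.one _, rfl⟩, ?_⟩
    simp
  eq_generateFrom := rfl

theorem continuous_character_re {a : Elem N} (ha : IsSelfAdjoint a) :
    Continuous fun V : Elem N →ₐ[ℂ] ℂ => (V a).re := by
  refine continuous_iff_continuousAt.2 fun V₀ => Metric.tendsto_nhds.2 fun ε hε => ?_
  obtain ⟨e, he, h1, h2⟩ := exists_projection_near V₀ a ha (half_pos hε)
  filter_upwards [(isOpen_character_eq_one he).mem_nhds h1] with V hV
  exact (h2 V hV).trans_lt (half_lt_self hε)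

theorem continuous_character_apply (a : Elem N) :
    Continuous fun V : Elem N →ₐ[ℂ] ℂ => V a := by
  have key : ∀ b : Elem N, IsSelfAdjoint b → Continuous fun V : Elem N →ₐ[ℂ] ℂ => V b := by
    intro b hb
    have h : (fun V : Elem N →ₐ[ℂ] ℂ => V b) = fun V => (((V b).re : ℝ) : ℂ) := by
      funext V
      have := character_star V b
      rw [hb.star_eq] at this
      exact (Complex.conj_eq_iff_re.1 this.symm).symm
    rw [h]
    exact Complex.continuous_ofReal.comp (continuous_character_re hb)
  have h : (fun V : Elem N →ₐ[ℂ] ℂ => V a) = fun V =>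
      V (realPart a : Elem N) + Complex.I * V (imaginaryPart a : Elem N) := by
    funext V
    conv_lhs => rw [← realPart_add_I_smul_imaginaryPart a, map_add, map_smul, smul_eq_mul]
  rw [h]
  exact (key _ (realPart a).2).add (continuous_const.mul (key _ (imaginaryPart a).2))

/-- A supremum over the unit ball of a family of continuous functions of the character which is
compatible with gluing is continuous. -/
theorem continuous_iSup_unitBall (hN : N.toStarSubalgebra ≤ center M)
    (f : {y : Elem M // ‖y‖ ≤ 1} → (Elem N →ₐ[ℂ] ℂ) → ℝ) (hf : ∀ y, Continuous (f y)) {C : ℝ}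
    (hC : ∀ y V, |f y V| ≤ C)
    (hloc : ∀ (V : Elem N →ₐ[ℂ] ℂ) (e : Elem N) (y y' : {y : Elem M // ‖y‖ ≤ 1}), V e = 1 →
      incl hN e * y.1 = incl hN e * y'.1 → f y V = f y' V) :
    Continuous fun V => ⨆ y, f y V := by
  have hbdd : ∀ V, BddAbove (Set.range fun y => f y V) := fun V =>
    ⟨C, by rintro _ ⟨y, rfl⟩; exact (abs_le.1 (hC y V)).2⟩
  refine continuous_iff_continuousAt.2 fun V₀ => tendsto_order.2 ⟨fun r hr => ?_, fun r hr => ?_⟩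
  · obtain ⟨y, hy⟩ := exists_lt_of_lt_ciSup hr
    filter_upwards [(hf y).continuousAt.eventually (lt_mem_nhds hy)] with V hV
    exact hV.trans_le (le_ciSup (hbdd V) y)
  -- Upper semicontinuity. If it fails, characters at which some witness exceeds `r'` accumulate at
  -- `V₀`. Zorn gives a maximal orthogonal family of projections, each with a witness exceeding `r'`
  -- throughout it; `Y` glues these witnesses.
  · obtain ⟨r', hr1, hr2⟩ := exists_between hr
    by_contra hcon
    have hfreq : ∃ᶠ V in nhds V₀, ∃ y, r' < f y V := by
      rw [Filter.not_eventually] at hcon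
      exact hcon.mono fun V hV => exists_lt_of_lt_ciSup (hr2.trans_le (not_lt.1 hV))
    let S : Set (Set (Elem N × {y : Elem M // ‖y‖ ≤ 1})) :=
      {P | (∀ p ∈ P, IsStarProjection p.1 ∧ ∀ V : Elem N →ₐ[ℂ] ℂ, V p.1 = 1 → r' < f p.2 V) ∧
        ∀ p ∈ P, ∀ q ∈ P, p ≠ q → p.1 * q.1 = 0}
    obtain ⟨P, hP⟩ : ∃ P, Maximal (· ∈ S) P := by
      refine zorn_subset S fun c hc hchain => ⟨⋃₀ c, ⟨?_, ?_⟩,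
        fun s hs => Set.subset_sUnion_of_mem hs⟩
      · rintro p ⟨s, hs, hp⟩
        exact (hc hs).1 p hp
      · rintro p ⟨s, hs, hp⟩ q ⟨t, ht, hq⟩ hpq
        rcases hchain.total hs ht with h | h
        · exact (hc ht).2 p (h hp) q hq hpq
        · exact (hc hs).2 p hp q (h hq) hpq
    obtain ⟨Y, hY, hglue⟩ := exists_glue hN (fun p : P => p.1.1) (fun p => (hP.prop.1 _ p.2).1)
      (fun p q hpq => hP.prop.2 _ p.2 _ q.2 fun h => hpq (Subtype.ext h))
      (fun p => p.1.2.1) (fun p => p.1.2.2)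
    have hfY : ∀ p ∈ P, ∀ V : Elem N →ₐ[ℂ] ℂ, V p.1 = 1 → r' < f ⟨Y, hY⟩ V := fun p hp V hV => by
      rw [hloc V p.1 ⟨Y, hY⟩ p.2 hV (hglue ⟨p, hp⟩)]
      exact (hP.prop.1 p hp).2 V hV
    have hlt : f ⟨Y, hY⟩ V₀ < r' := (le_ciSup (hbdd V₀) _).trans_lt hr1
    -- Near `V₀` the glued `Y` stays below `r'`, yet some `y` exceeds `r'` at a nearby `V`; by
    -- continuity both hold on a projection `e` with `V e = 1`.
    obtain ⟨V, ⟨y, hy⟩, hV⟩ := (hfreq.and_eventually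
      ((hf ⟨Y, hY⟩).continuousAt.eventually (gt_mem_nhds hlt))).exists
    obtain ⟨_, ⟨e, he, rfl⟩, heV, hsub⟩ := (isTopologicalBasis_characters hN).mem_nhds_iff.1
      (Filter.inter_mem ((hf ⟨Y, hY⟩).continuousAt.eventually (gt_mem_nhds hV))
        ((hf y).continuousAt.eventually (lt_mem_nhds hy)))
    -- A character of a nonzero product would see `Y` both below and above `r'`. Hence `(e, y)`
    -- extends the family, and maximality puts it inside, which is again absurd at `V`.
    have hort : ∀ p ∈ P, e * p.1 = 0 := by
      intro p hp
      by_contra h0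
      obtain ⟨W, hW⟩ := exists_character_eq_one hN
        (isStarProjection_mul hN he (hP.prop.1 p hp).1) h0
      obtain ⟨hW1, hW2⟩ := character_eq_one_of_mul he (hP.prop.1 p hp).1 hW
      exact lt_asymm (hsub hW1).1 (hfY p hp W hW2)
    have hins : insert (e, y) P ∈ S := by
      refine ⟨?_, ?_⟩
      · rintro p (rfl | hp)
        · exact ⟨he, fun W hW => (hsub hW).2⟩
        · exact hP.prop.1 p hp
      · rintro p (rfl | hp) q (rfl | hq) hpq
        · exact absurd rfl hpq
        · exact hort q hq
        · rw [elem_mul_comm hN]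
          exact hort p hp
        · exact hP.prop.2 p hp q hq hpq
    have hmem : (e, y) ∈ P := hP.le_of_ge hins (Set.subset_insert _ _) (Set.mem_insert _ _)
    exact lt_asymm hV (hfY _ hmem V heV)

variable {hN : N.toStarSubalgebra ≤ center M} (E : CentralExpectation M N hN)

theorem fiberMk_snoc_congr {V : Elem N →ₐ[ℂ] ℂ} {k : ℕ} (z : Fin k → Elem M) {y y' : Elem M}
    (h : fiberMk E V y = fiberMk E V y') (i : Fin (k + 1)) :
    fiberMk E V ((Fin.snoc z y : Fin (k + 1) → Elem M) i) =
      fiberMk E V ((Fin.snoc z y' : Fin (k + 1) → Elem M) i) := by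
  refine Fin.lastCases ?_ (fun j => ?_) i
  · simpa using h
  · simp

/-- The value of a formula depends continuously on the character. -/
theorem continuous_interp {α : Type u} {v : α → Elem M} (hv : ∀ i, ‖v i‖ ≤ 1) {k : ℕ}
    (φ : Formula α k) {z : Fin k → Elem M} (hz : ∀ i, ‖z i‖ ≤ 1) :
    Continuous fun V : Elem N →ₐ[ℂ] ℂ => φ.interp (fiberState E V) v z := by
  induction φ with
  | reTr p => exact Complex.continuous_re.comp (continuous_character_apply _)
  | imTr p => exact Complex.continuous_im.comp (continuous_character_apply _)
  | conn f φ ih => exact f.continuous.comp (continuous_pi fun i => ih i hz)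
  | sup φ ih =>
    obtain ⟨C, -, hC⟩ := exists_abs_interp_le E φ
    refine continuous_iSup_unitBall hN
      (fun y V => φ.interp (fiberState E V) v (Fin.snoc z y.1))
      (fun y => ih (norm_snoc_le hz y.2)) (C := C)
      (fun y V => hC V v _ hv (norm_snoc_le hz y.2)) fun V e y y' hV h => ?_
    exact interp_congr E V φ (fun _ => rfl)
      (fiberMk_snoc_congr E z (fiberMk_eq_of_incl_mul_eq E V hV h))
  | inf φ ih =>
    obtain ⟨C, -, hC⟩ := exists_abs_interp_le E φ
    have h := continuous_iSup_unitBall hN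
      (fun y V => -φ.interp (fiberState E V) v (Fin.snoc z y.1))
      (fun y => (ih (norm_snoc_le hz y.2)).neg) (C := C)
      (fun y V => by rw [abs_neg]; exact hC V v _ hv (norm_snoc_le hz y.2))
      fun V e y y' hV h => congrArg Neg.neg (interp_congr E V φ (fun _ => rfl)
        (fiberMk_snoc_congr E z (fiberMk_eq_of_incl_mul_eq E V hV h)))
    refine h.neg.congr fun V => ?_
    simp only [Formula.interp]
    -- The infimum case is the supremum case for the negated family.
    change -sSup (Set.range _) = sInf (Set.range _)
    rw [Real.sInf_def, ← Set.image_neg_eq_neg, ← Set.range_comp]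
    rfl

end Continuity

/-! ### Diagonal gluing at a countably incomplete character -/

section Saturation

variable {H : Type u} [NormedAddCommGroup H] [InnerProductSpace ℂ H] [CompleteSpace H]
  {M N : VonNeumannAlgebra H}

theorem isStarProjection_sub_of_mul_eq (hN : N.toStarSubalgebra ≤ center M) {e f : Elem N}
    (he : IsStarProjection e) (hf : IsStarProjection f) (h : f * e = f) :
    IsStarProjection (e - f) := by
  refine ⟨?_, he.isSelfAdjoint.sub hf.isSelfAdjoint⟩
  change (e - f) * (e - f) = e - f
  rw [sub_mul, mul_sub, mul_sub, he.isIdempotentElem.eq, hf.isIdempotentElem.eq,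
    elem_mul_comm hN e f, h]
  abel

theorem le_of_isStarProjection_of_mul_eq (hN : N.toStarSubalgebra ≤ center M) {e f : Elem N}
    (he : IsStarProjection e) (hf : IsStarProjection f) (h : f * e = f) : f ≤ e := by
  have hp := isStarProjection_sub_of_mul_eq hN he hf h
  have h1 := star_mul_self_nonneg' (e - f)
  rw [hp.isSelfAdjoint.star_eq, hp.isIdempotentElem.eq] at h1
  have h2 : (0 : H →L[ℂ] H) ≤ (e : H →L[ℂ] H) - f := h1
  exact (sub_nonneg.1 h2 : (f : H →L[ℂ] H) ≤ e)

theorem exists_projection_of_mem_nhds (hN : N.toStarSubalgebra ≤ center M)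
    {U : Elem N →ₐ[ℂ] ℂ} {W : Set (Elem N →ₐ[ℂ] ℂ)} (hW : W ∈ nhds U) :
    ∃ e : Elem N, IsStarProjection e ∧ U e = 1 ∧ ∀ V : Elem N →ₐ[ℂ] ℂ, V e = 1 → V ∈ W := by
  obtain ⟨_, ⟨e, he, rfl⟩, heU, hsub⟩ := (isTopologicalBasis_characters hN).mem_nhds_iff.1 hW
  exact ⟨e, he, heU, fun V hV => hsub hV⟩

/-- A family of approximate zeros at a countably incomplete character may be glued to a zero. -/
theorem exists_common_zero (hN : N.toStarSubalgebra ≤ center M) {U : Elem N →ₐ[ℂ] ℂ}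
    (hU : IsCountablyIncomplete U) {β : Type*} (F : ℕ → (β → Elem M) → (Elem N →ₐ[ℂ] ℂ) → ℝ)
    (hcont : ∀ i x, (∀ b, ‖x b‖ ≤ 1) → Continuous (F i x))
    (hloc : ∀ i (V : Elem N →ₐ[ℂ] ℂ) (e : Elem N) (x x' : β → Elem M), V e = 1 →
      (∀ b, incl hN e * x b = incl hN e * x' b) → F i x V = F i x' V)
    (happ : ∀ m : ℕ, ∃ x : β → Elem M, (∀ b, ‖x b‖ ≤ 1) ∧
      ∀ i ≤ m, |F i x U| < 1 / ((m : ℝ) + 1)) :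
    ∃ x : β → Elem M, (∀ b, ‖x b‖ ≤ 1) ∧ ∀ i, F i x U = 0 := by
  obtain ⟨p, hp, hpanti, hpinf, hpU⟩ := hU
  choose x hx hxF using happ
  have hg : ∀ m : ℕ, ∃ g : Elem N, IsStarProjection g ∧ U g = 1 ∧
      ∀ V : Elem N →ₐ[ℂ] ℂ, V g = 1 → ∀ i ≤ m, |F i (x m) V| < 1 / ((m : ℝ) + 1) := by
    intro m
    refine exists_projection_of_mem_nhds hN
      (W := {V | ∀ i ≤ m, |F i (x m) V| < 1 / ((m : ℝ) + 1)}) ?_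
    exact (Filter.eventually_all_finite (Set.finite_Iic m)).2 fun i hi =>
      (hcont i (x m) (hx m)).abs.continuousAt.eventually (gt_mem_nhds (hxF m i hi))
  choose g hgp hgU hgF using hg
  let q : ℕ → Elem N := fun m => g m * p m
  have hq : ∀ m, IsStarProjection (q m) := fun m => isStarProjection_mul hN (hgp m) (hp m)
  have hqU : ∀ m, U (q m) = 1 := fun m => by simp only [q, map_mul, hgU, hpU, one_mul]
  -- `h m` is the product of `q 0, …, q m`: it decreases, lies below both `g m` and `p m`, and still
  -- has `U (h m) = 1`.
  let h : ℕ → Elem N := fun m => Nat.rec (q 0) (fun m a => a * q (m + 1)) m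
  have hsucc : ∀ m, h (m + 1) = h m * q (m + 1) := fun m => rfl
  have hh : ∀ m, IsStarProjection (h m) := by
    intro m
    induction m with
    | zero => exact hq 0
    | succ m ih => exact isStarProjection_mul hN ih (hq _)
  have hhU : ∀ m, U (h m) = 1 := by
    intro m
    induction m with
    | zero => exact hqU 0
    | succ m ih => rw [hsucc, map_mul, ih, hqU, one_mul]
  have hhq : ∀ m, h m * q m = h m := by
    intro m
    cases m with
    | zero => exact (hq 0).isIdempotentElem
    | succ m => rw [hsucc, mul_assoc, (hq _).isIdempotentElem.eq]
  have habs : ∀ i j, i ≤ j → h j * h i = h j := by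
    intro i j hij
    induction hij with
    | refl => exact (hh i).isIdempotentElem
    | step _ ih => rw [hsucc, mul_assoc, elem_mul_comm hN (q _), ← mul_assoc, ih]
  have habs' : ∀ i j, i ≤ j → h i * h j = h j := fun i j hij => by
    rw [elem_mul_comm hN, habs i j hij]
  -- On the layer `e m`, which lies below `g m`, the glued tuple is `x m`. Each layer has `U`-value
  -- `0`, so information reaches `U` only through continuity.
  let e : ℕ → Elem N := fun m => h m - h (m + 1)
  have he : ∀ m, IsStarProjection (e m) := fun m =>
    isStarProjection_sub_of_mul_eq hN (hh m) (hh (m + 1)) (habs _ _ m.le_succ)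
  have hlt : ∀ i j, i < j → e i * e j = 0 := by
    intro i j hij
    simp only [e, sub_mul, mul_sub]
    rw [habs' i j hij.le, habs' i (j + 1) (by omega), habs' (i + 1) j hij,
      habs' (i + 1) (j + 1) (by omega), sub_self,
      sub_self, sub_self]
  have hort : ∀ i j, i ≠ j → e i * e j = 0 := by
    intro i j hij
    rcases lt_or_gt_of_ne hij with hij | hij
    · exact hlt i j hij
    · rw [elem_mul_comm hN, hlt j i hij]
  choose X hX hXe using fun b => exists_glue hN e he hort (fun m => x m b) (fun m => hx m b)
  refine ⟨X, hX, fun i => ?_⟩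
  by_contra hne
  obtain ⟨m₀, hm₀⟩ := exists_nat_one_div_lt (abs_pos.2 hne)
  set m := max i m₀ with hm
  have hmlt : 1 / ((m : ℝ) + 1) < |F i X U| :=
    (Nat.one_div_le_one_div (le_max_right _ _)).trans_lt hm₀
  obtain ⟨f, hf, hfU, hfF⟩ := exists_projection_of_mem_nhds hN
    ((hcont i X hX).abs.continuousAt.eventually (lt_mem_nhds hmlt))
  -- If `f` missed every layer from `m` on, then `f * h m = f * h j ≤ p j` for all `j ≥ m`, so `f *
  -- h m = 0`, contradicting `U (f * h m) = 1`.
  have hex : ∃ j, m ≤ j ∧ f * e j ≠ 0 := by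
    by_contra! hall
    have hstab : ∀ j, m ≤ j → f * h m = f * h j := by
      intro j hj
      induction hj with
      | refl => rfl
      | step hj ih =>
        rw [ih, ← sub_eq_zero, ← mul_sub]
        exact hall _ hj
    have hr : IsStarProjection (f * h m) := isStarProjection_mul hN hf (hh m)
    have hle : ∀ j, m ≤ j → f * h m ≤ p j := by
      intro j hj
      refine le_of_isStarProjection_of_mul_eq hN (hp j) hr ?_
      rw [hstab j hj]
      conv_lhs => rw [← hhq j]
      simp only [q]
      rw [mul_assoc, mul_assoc, mul_assoc, (hp j).isIdempotentElem.eq]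
      conv_rhs => rw [← hhq j]
    have hle0 : f * h m ≤ 0 := by
      refine hpinf.2 ?_
      rintro _ ⟨j, rfl⟩
      rcases le_total m j with hj | hj
      · exact hle j hj
      · exact (hle m le_rfl).trans (hpanti hj)
    have hge0 : 0 ≤ f * h m := by
      have := star_mul_self_nonneg' (f * h m)
      rwa [hr.isSelfAdjoint.star_eq, hr.isIdempotentElem.eq] at this
    have h1 : U (f * h m) = 1 := by rw [map_mul, hfU, hhU, one_mul]
    rw [le_antisymm hle0 hge0, map_zero] at h1
    exact zero_ne_one h1
  obtain ⟨j, hj, hne⟩ := hex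
  -- At a character of `f * e j`, the value at `X` exceeds `1 / (m + 1)` because of `f`, but it
  -- equals the value at `x j`, which is below `1 / (j + 1)`.
  obtain ⟨V, hV⟩ := exists_character_eq_one hN (isStarProjection_mul hN hf (he j)) hne
  obtain ⟨hVf, hVe⟩ := character_eq_one_of_mul hf (he j) hV
  have hVh : V (h j) = 1 := by
    have h1 : h j * e j = e j := by
      simp only [e, mul_sub]
      rw [habs' j j le_rfl, habs' j (j + 1) j.le_succ]
    have h2 := congrArg V h1
    rwa [map_mul, hVe, mul_one] at h2
  have hVg : V (g j) = 1 := by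
    rw [← hhq j] at hVh
    have h1 := (character_eq_one_of_mul (hh j) (hq j) hVh).2
    exact (character_eq_one_of_mul (hgp j) (hp j) h1).1
  have h1 : 1 / ((m : ℝ) + 1) < |F i X V| := hfF V hVf
  rw [hloc i V (e j) X (x j) hVe fun b => hXe b j] at h1
  have h2 := hgF j V hVg i ((le_max_left _ _).trans hj)
  exact lt_asymm h1 (h2.trans_le (Nat.one_div_le_one_div hj))

end Saturation

/-! ### Separability of the language -/

section Separability

variable {H : Type u} [NormedAddCommGroup H] [InnerProductSpace ℂ H] [CompleteSpace H]
  {M N : VonNeumannAlgebra H}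

theorem countable_adjoin_rat {A : Type*} [Semiring A] [Algebra ℚ A] {s : Set A}
    (hs : s.Countable) : (Algebra.adjoin ℚ s : Set A).Countable := by
  have h := Algebra.lift_cardinalMk_adjoin_le ℚ s
  have hs' : #s ≤ ℵ₀ := Cardinal.le_aleph0_iff_set_countable.2 hs
  rw [← Cardinal.le_aleph0_iff_set_countable, ← Cardinal.lift_le_aleph0]
  refine h.trans ?_
  simp [hs']

theorem norm_algebraMap_elem_le (M : VonNeumannAlgebra H) (r : ℂ) :
    ‖algebraMap ℂ (Elem M) r‖ ≤ ‖r‖ := by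
  rw [Algebra.algebraMap_eq_smul_one, norm_smul]
  exact mul_le_of_le_one_right (norm_nonneg _) ContinuousLinearMap.norm_id_le

/-- There are countably many `*`-polynomials which approximate all of them uniformly on the unit
ball. -/
theorem exists_countable_dense_starPoly (M : VonNeumannAlgebra H) (α : Type u) [Countable α] :
    ∃ P : Set (StarPoly α), P.Countable ∧ ∀ p : StarPoly α, ∀ ε : ℝ, 0 < ε → ∃ q ∈ P,
      ∀ v : α → Elem M, (∀ i, ‖v i‖ ≤ 1) → ‖p.eval v - q.eval v‖ ≤ ε := by
  obtain ⟨D, hDc, hD⟩ := TopologicalSpace.exists_countable_dense ℂ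
  -- Adjoining over `ℚ` keeps the algebra countable; the dense scalars `D` enter as generators.
  let s : Set (StarPoly α) := Set.range (FreeAlgebra.ι ℂ) ∪ algebraMap ℂ (StarPoly α) '' D
  refine ⟨Algebra.adjoin ℚ s, countable_adjoin_rat ((Set.countable_range _).union (hDc.image _)),
    fun p => ?_⟩
  induction p using FreeAlgebra.induction with
  | grade0 r =>
    intro ε hε
    obtain ⟨d, hd, hrd⟩ := Metric.dense_iff.1 hD r ε hε
    refine ⟨algebraMap ℂ _ d, Algebra.subset_adjoin (Or.inr ⟨d, hrd, rfl⟩), fun v _ => ?_⟩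
    simp only [StarPoly.eval, AlgHom.commutes]
    rw [← map_sub]
    refine (norm_algebraMap_elem_le M _).trans ?_
    rw [← dist_eq_norm, dist_comm]
    exact (Metric.mem_ball.1 hd).le
  | grade1 x =>
    intro ε hε
    exact ⟨_, Algebra.subset_adjoin (Or.inl ⟨x, rfl⟩), fun v _ => by simpa using hε.le⟩
  | mul p q hp hq =>
    intro ε hε
    obtain ⟨C, hC, hCq⟩ := exists_norm_eval_le M q
    -- `p'` is fixed first, since the precision required of `q'` depends on the bound for `p'`.
    obtain ⟨p', hp', hpp⟩ := hp (ε / 2 / (C + 1)) (by positivity)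
    obtain ⟨C', hC', hCp⟩ := exists_norm_eval_le M p'
    obtain ⟨q', hq', hqq⟩ := hq (ε / 2 / (C' + 1)) (by positivity)
    refine ⟨p' * q', Subalgebra.mul_mem _ hp' hq', fun v hv => ?_⟩
    have e : StarPoly.eval (p * q) v - (p' * q').eval v =
        (StarPoly.eval p v - p'.eval v) * StarPoly.eval q v +
          p'.eval v * (StarPoly.eval q v - q'.eval v) := by
      simp only [StarPoly.eval, map_mul]
      noncomm_ring
    have h1 : ‖(StarPoly.eval p v - p'.eval v) * StarPoly.eval q v‖ ≤ ε / 2 := by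
      calc _ ≤ ‖StarPoly.eval p v - p'.eval v‖ * ‖StarPoly.eval q v‖ := norm_mul_le _ _
        _ ≤ ε / 2 / (C + 1) * (C + 1) :=
          mul_le_mul (hpp v hv) ((hCq v hv).trans (by linarith)) (norm_nonneg _) (by positivity)
        _ = ε / 2 := by field_simp
    have h2 : ‖p'.eval v * (StarPoly.eval q v - q'.eval v)‖ ≤ ε / 2 := by
      calc _ ≤ ‖p'.eval v‖ * ‖StarPoly.eval q v - q'.eval v‖ := norm_mul_le _ _
        _ ≤ (C' + 1) * (ε / 2 / (C' + 1)) :=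
          mul_le_mul ((hCp v hv).trans (by linarith)) (hqq v hv) (norm_nonneg _) (by positivity)
        _ = ε / 2 := by field_simp
    rw [e]
    exact (norm_add_le _ _).trans (by linarith)
  | add p q hp hq =>
    intro ε hε
    obtain ⟨p', hp', hpp⟩ := hp (ε / 2) (by positivity)
    obtain ⟨q', hq', hqq⟩ := hq (ε / 2) (by positivity)
    refine ⟨p' + q', Subalgebra.add_mem _ hp' hq', fun v hv => ?_⟩
    have e : StarPoly.eval (p + q) v - (p' + q').eval v =
        (StarPoly.eval p v - p'.eval v) + (StarPoly.eval q v - q'.eval v) := by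
      simp only [StarPoly.eval, map_add]
      abel
    rw [e]
    exact (norm_add_le _ _).trans (by linarith [hpp v hv, hqq v hv])

/-- The compact-open topology on `C(Fin m → ℝ, ℝ)` is separable, and its convergence is uniform on
compact sets. -/
theorem exists_countable_dense_connectives (m : ℕ) :
    ∃ D : Set C(Fin m → ℝ, ℝ), D.Countable ∧ ∀ f : C(Fin m → ℝ, ℝ), ∀ K : Set (Fin m → ℝ),
      IsCompact K → ∀ ε : ℝ, 0 < ε → ∃ g ∈ D, ∀ x ∈ K, |f x - g x| < ε := by
  obtain ⟨D, hDc, hD⟩ := TopologicalSpace.exists_countable_dense C(Fin m → ℝ, ℝ)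
  refine ⟨D, hDc, fun f K hK ε hε => ?_⟩
  have h := Metric.tendstoUniformlyOn_iff.1
    (ContinuousMap.tendsto_iff_forall_isCompact_tendstoUniformlyOn.1
      (Filter.tendsto_id (x := nhds f)) K hK) ε hε
  obtain ⟨g, hg, hgD⟩ := ((mem_closure_iff_frequently.1 (hD f)).and_eventually h).exists
  exact ⟨g, hg, hgD⟩

theorem abs_iSup_sub_iSup_le {ι : Type*} [Nonempty ι] {f g : ι → ℝ} {C ε : ℝ}
    (hf : ∀ i, |f i| ≤ C) (hg : ∀ i, |g i| ≤ C) (h : ∀ i, |f i - g i| ≤ ε) :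
    |(⨆ i, f i) - ⨆ i, g i| ≤ ε := by
  have hbf : BddAbove (Set.range f) := ⟨C, by rintro _ ⟨i, rfl⟩; exact (abs_le.1 (hf i)).2⟩
  have hbg : BddAbove (Set.range g) := ⟨C, by rintro _ ⟨i, rfl⟩; exact (abs_le.1 (hg i)).2⟩
  have h1 : ⨆ i, f i ≤ (⨆ i, g i) + ε := ciSup_le fun i => by
    linarith [(abs_le.1 (h i)).2, le_ciSup hbg i]
  have h2 : ⨆ i, g i ≤ (⨆ i, f i) + ε := ciSup_le fun i => by
    linarith [(abs_le.1 (h i)).1, le_ciSup hbf i]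
  exact abs_le.2 ⟨by linarith, by linarith⟩

theorem abs_iInf_sub_iInf_le {ι : Type*} [Nonempty ι] {f g : ι → ℝ} {C ε : ℝ}
    (hf : ∀ i, |f i| ≤ C) (hg : ∀ i, |g i| ≤ C) (h : ∀ i, |f i - g i| ≤ ε) :
    |(⨅ i, f i) - ⨅ i, g i| ≤ ε := by
  have hbf : BddBelow (Set.range f) := ⟨-C, by rintro _ ⟨i, rfl⟩; exact (abs_le.1 (hf i)).1⟩
  have hbg : BddBelow (Set.range g) := ⟨-C, by rintro _ ⟨i, rfl⟩; exact (abs_le.1 (hg i)).1⟩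
  have h1 : (⨅ i, g i) - ε ≤ ⨅ i, f i := le_ciInf fun i => by
    linarith [(abs_le.1 (h i)).1, ciInf_le hbg i]
  have h2 : (⨅ i, f i) - ε ≤ ⨅ i, g i := le_ciInf fun i => by
    linarith [(abs_le.1 (h i)).2, ciInf_le hbf i]
  exact abs_le.2 ⟨by linarith, by linarith⟩

/-- The formulas built in at most `j` steps from given atomic `*`-polynomials and connectives. -/
def formulaLevel {α : Type u} (P : ∀ k, Set (StarPoly (α ⊕ Fin k)))
    (D : ∀ m, Set C(Fin m → ℝ, ℝ)) : ℕ → ∀ k, Set (Formula α k)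
  | 0, k => Formula.reTr '' P k ∪ Formula.imTr '' P k
  | j + 1, k => formulaLevel P D j k ∪
      (⋃ m, Set.image2 Formula.conn (D m)
        {φ : Fin m → Formula α k | ∀ i, φ i ∈ formulaLevel P D j k}) ∪
      (Formula.sup '' formulaLevel P D j (k + 1) ∪ Formula.inf '' formulaLevel P D j (k + 1))

theorem countable_formulaLevel {α : Type u} {P : ∀ k, Set (StarPoly (α ⊕ Fin k))}
    {D : ∀ m, Set C(Fin m → ℝ, ℝ)} (hP : ∀ k, (P k).Countable) (hD : ∀ m, (D m).Countable)
    (j k : ℕ) : (formulaLevel P D j k).Countable := by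
  induction j generalizing k with
  | zero => exact ((hP k).image _).union ((hP k).image _)
  | succ j ih =>
    refine ((ih k).union (Set.countable_iUnion fun m => ?_)).union
      (((ih _).image _).union ((ih _).image _))
    exact (hD m).image2 (Set.countable_pi fun _ => ih k) _

theorem formulaLevel_mono {α : Type u} {P : ∀ k, Set (StarPoly (α ⊕ Fin k))}
    {D : ∀ m, Set C(Fin m → ℝ, ℝ)} {i j : ℕ} (hij : i ≤ j) (k : ℕ) :
    formulaLevel P D i k ⊆ formulaLevel P D j k := by
  induction hij with
  | refl => exact subset_rfl
  | step _ ih => exact ih.trans fun φ hφ => Or.inl (Or.inl hφ)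

variable {hN : N.toStarSubalgebra ≤ center M} (E : CentralExpectation M N hN)

/-- Two formulas are `ε`-close if their values on the unit ball differ by at most `ε`, for all
characters. -/
def FormulaClose {α : Type u} {k : ℕ} (ε : ℝ) (φ ψ : Formula α k) : Prop :=
  ∀ (V : Elem N →ₐ[ℂ] ℂ) (v : α → Elem M) (z : Fin k → Elem M),
    (∀ i, ‖v i‖ ≤ 1) → (∀ i, ‖z i‖ ≤ 1) →
      |φ.interp (fiberState E V) v z - ψ.interp (fiberState E V) v z| ≤ ε

theorem exists_formulaLevel_close {α : Type u} {P : ∀ k, Set (StarPoly (α ⊕ Fin k))}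
    {D : ∀ m, Set C(Fin m → ℝ, ℝ)}
    (hP : ∀ k, ∀ p : StarPoly (α ⊕ Fin k), ∀ ε : ℝ, 0 < ε → ∃ q ∈ P k,
      ∀ v : α ⊕ Fin k → Elem M, (∀ i, ‖v i‖ ≤ 1) → ‖p.eval v - q.eval v‖ ≤ ε)
    (hD : ∀ m, ∀ f : C(Fin m → ℝ, ℝ), ∀ K : Set (Fin m → ℝ),
      IsCompact K → ∀ ε : ℝ, 0 < ε → ∃ g ∈ D m, ∀ x ∈ K, |f x - g x| < ε)
    {k : ℕ} (φ : Formula α k) :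
    ∀ ε : ℝ, 0 < ε → ∃ j, ∃ ψ ∈ formulaLevel P D j k, FormulaClose E ε φ ψ := by
  have hpoly : ∀ {k} (p : StarPoly (α ⊕ Fin k)) (ε : ℝ), 0 < ε → ∃ q ∈ P k,
      ∀ (V : Elem N →ₐ[ℂ] ℂ) (v : α ⊕ Fin k → Elem M), (∀ i, ‖v i‖ ≤ 1) →
        ‖fiberState E V (p.eval v) - fiberState E V (q.eval v)‖ ≤ ε := by
    intro k p ε hε
    obtain ⟨q, hq, h⟩ := hP k p (ε / 2) (by positivity)
    refine ⟨q, hq, fun V v hv => ?_⟩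
    rw [← map_sub]
    refine (norm_fiberState_le E V _).trans ?_
    linarith [h v hv]
  induction φ with
  | reTr p =>
    intro ε hε
    obtain ⟨q, hq, h⟩ := hpoly p ε hε
    refine ⟨0, _, Or.inl ⟨q, hq, rfl⟩, fun V v z hv hz => ?_⟩
    refine le_trans ?_ (h V (Sum.elim v z) (norm_sumElim_le hv hz))
    exact Complex.abs_re_le_norm (_ - _)
  | imTr p =>
    intro ε hε
    obtain ⟨q, hq, h⟩ := hpoly p ε hε
    refine ⟨0, _, Or.inr ⟨q, hq, rfl⟩, fun V v z hv hz => ?_⟩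
    refine le_trans ?_ (h V (Sum.elim v z) (norm_sumElim_le hv hz))
    exact Complex.abs_im_le_norm (_ - _)
  | @conn k m f φ ih =>
    intro ε hε
    choose C hC0 hC using fun i => exists_abs_interp_le E (φ i)
    -- The margin `1` makes the box also contain the values of the approximants `ψ i`, which are
    -- chosen within `1` of `φ i`.
    let K : Set (Fin m → ℝ) := Set.univ.pi fun i => Set.Icc (-(C i + 1)) (C i + 1)
    have hK : IsCompact K := isCompact_univ_pi fun i => isCompact_Icc
    obtain ⟨g, hg, hfg⟩ := hD m f K hK (ε / 2) (by positivity)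
    obtain ⟨δ, hδ, hfδ⟩ := Metric.uniformContinuousOn_iff.1
      (hK.uniformContinuousOn_of_continuous f.continuous.continuousOn) (ε / 2) (by positivity)
    choose j ψ hψ hclose using fun i => ih i (min (δ / 2) 1) (by positivity)
    refine ⟨Finset.univ.sup j + 1, .conn g ψ, Or.inl (Or.inr (Set.mem_iUnion.2 ⟨m, g, hg, ψ,
      fun i => formulaLevel_mono (Finset.le_sup (Finset.mem_univ i)) k (hψ i), rfl⟩)),
      fun V v z hv hz => ?_⟩
    have hφK : (fun i => (φ i).interp (fiberState E V) v z) ∈ K := fun i _ => by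
      have := abs_le.1 (hC i V v z hv hz)
      exact ⟨by linarith [this.1], by linarith [this.2]⟩
    have hψK : (fun i => (ψ i).interp (fiberState E V) v z) ∈ K := fun i _ => by
      have h1 := abs_le.1 (hC i V v z hv hz)
      have h2 := abs_le.1 ((hclose i V v z hv hz).trans (min_le_right _ _))
      exact ⟨by linarith [h1.1, h2.2], by linarith [h1.2, h2.1]⟩
    have hd : dist (fun i => (φ i).interp (fiberState E V) v z)
        (fun i => (ψ i).interp (fiberState E V) v z) < δ := by
      refine (dist_pi_lt_iff hδ).2 fun i => ?_
      exact ((hclose i V v z hv hz).trans (min_le_left _ _)).trans_lt (half_lt_self hδ)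
    have h1 := hfδ _ hφK _ hψK hd
    have h2 := hfg _ hψK
    simp only [Formula.interp]
    rw [Real.dist_eq] at h1
    exact (abs_sub_le _ _ _).trans (by linarith)
  | sup φ ih =>
    intro ε hε
    obtain ⟨j, ψ, hψ, h⟩ := ih ε hε
    obtain ⟨C, -, hC⟩ := exists_abs_interp_le E φ
    obtain ⟨C', -, hC'⟩ := exists_abs_interp_le E ψ
    refine ⟨j + 1, .sup ψ, Or.inr (Or.inl ⟨ψ, hψ, rfl⟩), fun V v z hv hz => ?_⟩
    exact abs_iSup_sub_iSup_le (C := max C C')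
      (fun y => (hC V v _ hv (norm_snoc_le hz y.2)).trans (le_max_left _ _))
      (fun y => (hC' V v _ hv (norm_snoc_le hz y.2)).trans (le_max_right _ _))
      fun y => h V v _ hv (norm_snoc_le hz y.2)
  | inf φ ih =>
    intro ε hε
    obtain ⟨j, ψ, hψ, h⟩ := ih ε hε
    obtain ⟨C, -, hC⟩ := exists_abs_interp_le E φ
    obtain ⟨C', -, hC'⟩ := exists_abs_interp_le E ψ
    refine ⟨j + 1, .inf ψ, Or.inr (Or.inr ⟨ψ, hψ, rfl⟩), fun V v z hv hz => ?_⟩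
    exact abs_iInf_sub_iInf_le (C := max C C')
      (fun y => (hC V v _ hv (norm_snoc_le hz y.2)).trans (le_max_left _ _))
      (fun y => (hC' V v _ hv (norm_snoc_le hz y.2)).trans (le_max_right _ _))
      fun y => h V v _ hv (norm_snoc_le hz y.2)

/-- Every set of formulas has a countable subset that is uniformly dense in it. -/
theorem exists_countable_dense_subset {α : Type u} [Countable α] {k : ℕ} (Γ : Set (Formula α k)) :
    ∃ Δ ⊆ Γ, Δ.Countable ∧ ∀ φ ∈ Γ, ∀ ε : ℝ, 0 < ε → ∃ ψ ∈ Δ, FormulaClose E ε φ ψ := by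
  choose P hPc hP using fun k : ℕ =>
    exists_countable_dense_starPoly M (α ⊕ Fin k)
  choose D hDc hD using exists_countable_dense_connectives
  -- The countable approximants need not lie in `Γ`. For each approximant and precision that some
  -- member of `Γ` meets, one such member is selected; the error at most doubles.
  let T : Set (Formula α k × ℕ) :=
    {t | (∃ j, t.1 ∈ formulaLevel P D j k) ∧ ∃ φ ∈ Γ, FormulaClose E (1 / ((t.2 : ℝ) + 1)) φ t.1}
  have hT : T.Countable := by
    refine ((Set.countable_iUnion fun j => countable_formulaLevel hPc hDc j k).prod
      (Set.countable_univ (α := ℕ))).mono ?_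
    rintro ⟨ψ, i⟩ ⟨⟨j, hj⟩, -⟩
    exact ⟨Set.mem_iUnion.2 ⟨j, hj⟩, trivial⟩
  have := hT.to_subtype
  choose c hcΓ hc using fun t : T => t.2.2
  refine ⟨Set.range c, ?_, Set.countable_range c, fun φ hφ ε hε => ?_⟩
  · rintro _ ⟨t, rfl⟩
    exact hcΓ t
  · obtain ⟨i, hi⟩ := exists_nat_one_div_lt (half_pos hε)
    obtain ⟨j, ψ, hψ, hclose⟩ := exists_formulaLevel_close E hP hD φ _
      (Nat.one_div_pos_of_nat (n := i))
    have ht : (ψ, i) ∈ T := ⟨⟨j, hψ⟩, φ, hφ, hclose⟩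
    refine ⟨_, ⟨⟨_, ht⟩, rfl⟩, fun V v z hv hz => ?_⟩
    have h1 := hclose V v z hv hz
    have h2 := hc ⟨_, ht⟩ V v z hv hz
    rw [abs_sub_comm] at h2
    refine (abs_sub_le _ (ψ.interp (fiberState E V) v z) _).trans ?_
    simp only at h2
    linarith

end Separability

/-! ### Saturation of the ultrafiber -/

section Main

variable {H : Type u} [NormedAddCommGroup H] [InnerProductSpace ℂ H] [CompleteSpace H]
  {M N : VonNeumannAlgebra H} {hN : N.toStarSubalgebra ≤ center M}

theorem isCountablySaturated_ultrafiber (E : CentralExpectation M N hN) (U : Elem N →ₐ[ℂ] ℂ)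
    (hU : IsCountablyIncomplete U) : IsCountablySaturated (ultrafiberTrace E U) := by
  intro S hS hcard n Γ hΓ
  have hSc : Countable S := by
    rw [← Cardinal.mk_le_aleph0_iff, ← Order.lt_succ_iff, Cardinal.succ_aleph0]
    exact hcard
  have hlift : ∀ a : Ultrafiber E U, ‖a‖ ≤ 1 → ∃ b : Elem M, ‖b‖ ≤ 1 ∧ fiberMk E U b = a := by
    intro a ha
    obtain ⟨b, hb⟩ := ballMk_surjective E U ⟨a, ha⟩
    exact ⟨b.1, b.2, congrArg Subtype.val hb⟩
  choose s hs hsmk using fun a : S => hlift a.1 (hS a.1 a.2)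
  have hvalue : ∀ (φ : Formula (Fin n ⊕ S) 0) (x : Fin n → Elem M),
      φ.value (ultrafiberTrace E U) (fun i => fiberMk E U (x i)) =
        φ.interp (fiberState E U) (Sum.elim x s) Fin.elim0 := by
    intro φ x
    rw [← interp_fiberMk, ← sumElim_fiberMk, Formula.value]
    congr 1
    · congr 1
      funext a
      exact (hsmk a).symm
    · exact Subsingleton.elim _ _
  -- `Δ` lies inside `Γ`, so it inherits finite approximate satisfiability.
  obtain ⟨Δ, hΔ, hΔc, hdense⟩ := exists_countable_dense_subset E Γ
  rcases Γ.eq_empty_or_nonempty with rfl | ⟨φ₀, hφ₀⟩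
  · exact ⟨0, fun i => by simp, fun φ hφ => hφ.elim⟩
  have hne : Δ.Nonempty := by
    obtain ⟨ψ, hψ, -⟩ := hdense φ₀ hφ₀ 1 one_pos
    exact ⟨ψ, hψ⟩
  obtain ⟨ψ, rfl⟩ := hΔc.exists_eq_range hne
  have hz : ∀ i : Fin 0, ‖(Fin.elim0 i : Elem M)‖ ≤ 1 := fun i => i.elim0
  obtain ⟨x, hx, hx0⟩ := exists_common_zero hN hU (β := Fin n)
    (fun i x V => (ψ i).interp (fiberState E V) (Sum.elim x s) Fin.elim0)
    (fun i x hx => continuous_interp E (norm_sumElim_le hx hs) (ψ i) hz)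
    (fun i V e x x' hV h => by
      refine interp_congr E V (ψ i) (fun j => ?_) fun _ => rfl
      rcases j with j | j
      · exact fiberMk_eq_of_incl_mul_eq E V hV (h j)
      · rfl)
    (fun m => by
      obtain ⟨x, hx, h⟩ := hΓ (ψ '' Set.Iic m) ((Set.image_subset_range _ _).trans hΔ)
        ((Set.finite_Iic m).image ψ) _ (Nat.one_div_pos_of_nat (n := m))
      choose y hy hyx using fun i => hlift (x i) (hx i)
      refine ⟨y, hy, fun i hi => ?_⟩
      rw [← hvalue, funext hyx]
      exact h _ ⟨i, hi, rfl⟩)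
  refine ⟨fun i => fiberMk E U (x i), fun i => (norm_fiberMk_le E U _).trans (hx i),
    fun φ hφ => ?_⟩
  rw [hvalue]
  by_contra hne0
  -- A nonzero value of `φ` would lie within half its size of the value of `ψ i`, which is zero.
  obtain ⟨_, ⟨i, rfl⟩, hclose⟩ := hdense φ hφ _ (half_pos (abs_pos.2 hne0))
  have h := hclose U (Sum.elim x s) Fin.elim0 (norm_sumElim_le hx hs) hz
  rw [hx0 i, sub_zero] at h
  linarith [abs_pos.2 hne0]

end Main

end TracialModelTheory

theorem mainTheorem9 {H : Type*} [NormedAddCommGroup H] [InnerProductSpace ℂ H] [CompleteSpace H]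
    (M N : VonNeumannAlgebra H) (hM : TracialModelTheory.IsFiniteVN M)
    (hN : N.toStarSubalgebra ≤ TracialModelTheory.center M)
    (E : TracialModelTheory.CentralExpectation M N hN)
    (U : TracialModelTheory.Elem N →ₐ[ℂ] ℂ)
    (hU : TracialModelTheory.IsCountablyIncomplete U) :
    TracialModelTheory.IsCountablySaturated (TracialModelTheory.ultrafiberTrace E U) := by
  exact TracialModelTheory.isCountablySaturated_ultrafiber E U hU
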